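/- Setting. A uniformly elliptic integrand on $\mathbb{R}^4$ is a one-homogeneous function $\Psi$ that is positive and smooth away from $0$ and for which $\{\Psi<1\}$ is uniformly convex. Let $\mu\in(0,1/2)$. Let $\phi:\mathbb{R}\to\mathbb{R}$ be even and analytic, with $\phi(s)=s\,\phi(1/s)$ for $s>0$, such that the function $\overline\Psi$ on $\mathbb{R}^2\times\mathbb{R}^2$ given by $\overline\Psi(x,y)=|y|\phi(|x|/|y|)$ for $y\neq0$ and $\overline\Psi(x,y)=|x|\phi(|y|/|x|)$ for $x\ne 0$ is a uniformly elliptic integrand, and such that $\frac{\phi(1)}{2\phi''(1)}=\mu(1-\mu)$. For an even $C^2$ function $s>0$ on $\mathbb{R}$ put $$G(s)(\tau)=s''(\tau)+\frac1\tau P(s'(\tau))+\frac1{s(\tau)}Q(s'(\tau)),\qquad P(z)=\frac{\phi'(z)}{\phi''(z)},\quad Q(z)=\frac{z\phi'(z)-\phi(z)}{\phi''(z)},$$ where at $\tau=0$ the term $\frac1\tau P(s'(\tau))$ is replaced by its limit. Let $\sigma:\mathbb{R}\to\mathbb{R}$ be even, analytic, locally uniformly convex, with $\sigma(0)=1$,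 $\sigma(\tau)>|\tau|$ and $G(\sigma)(\tau)=0$ for all $\tau\in\mathbb{R}$, and $\sigma(\tau)=\tau+a\tau^{-\mu}+o(\tau^{-\mu})$ as $\tau\to\infty$ for some $a>0$. (Thus $\{|y|=\sigma(|x|)\}$ is a critical hypersurface of $\int\overline\Psi(\nu)\,dA$ asymptotic to the cone $\{|x|=|y|\}$.) Let $L$ be the linearization of $G$ at $\sigma$, $$Lf=f''+\Big(\frac1\tau+\frac{\sigma'}{\sigma}+\frac{\sigma''\phi'''(\sigma')}{\phi''(\sigma')}\Big)f'+\frac{\phi(\sigma')-\sigma'\phi'(\sigma')}{\sigma^2\phi''(\sigma')}f$$ (again with $f'(\tau)/\tau$ replaced by its limit at $\tau=0$), let $f_0=\sigma-\tau\sigma'$ and $p(\tau)=\tau\sigma(\tau)\phi''(\sigma'(\tau))$, and let $$f_1(\tau)=f_0(\tau)\int_0^\tau\frac{1}{f_0(t)^2p(t)}\int_0^t\sigma(s)^{-5/2}p(s)f_0(s)\,ds\,dt .$$ Proposition. The function $f_1$ is smooth and even on $\mathbb{R}$ and solves $Lf_1=\sigma^{-5/2}$ on $\mathbb{R}$, $f_1(0)=f_1'(0)=0$.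 Moreover there exist $\epsilon_0>0$ and $c>0$ such that the functions $$\overline\sigma=\sigma+\epsilon_0f_1,\qquad \underline\sigma=\sigma-\epsilon_0f_1$$ are even, locally uniformly convex and larger than $|\tau|$ on $\mathbb{R}$, and have on $(0,\infty)$ the form $$\overline\sigma=\tau+\overline a\,\tau^{-\mu}+\overline r(\tau),\qquad \underline\sigma=\tau+\underline a\,\tau^{-\mu}+\underline r(\tau)$$ with constants $\overline a,\underline a>0$ and smooth functions $\overline r,\underline r$ on $(0,\infty)$ such that, for $r\in\{\overline r,\underline r\}$, $k\in\{0,1,2\}$ and all $\tau\ge1$, $$|r^{(k)}(\tau)|\le c^{-1}\Big|\frac{d^k}{d\tau^k}\tau^{-1/2}\Big| .$$ Furthermore, for all $\tau\in\mathbb{R}$, $$G(\overline\sigma)(\tau)\ge c\,\sigma(\tau)^{-5/2},\qquad -G(\underline\sigma)(\tau)\ge c\,\sigma(\tau)^{-5/2},\qquad \tfrac12\overline\sigma(2\tau)\le\underline\sigma(\tau)\le\overline\sigma(\tau).$$ -/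

import Mathlib

noncomputable section

/-! ### Uniformly elliptic integrands -/

/-- A set is uniformly convex (of quadratic order): the midpoint of any two of its points is
surrounded by a ball inside the set whose radius is a fixed multiple of the squared distance. For
bounded open sets with smooth boundary this says that the principal curvatures of the boundary are
bounded below by a positive constant. -/
def IsUniformlyConvexSet {n : ℕ} (K : Set (EuclideanSpace ℝ (Fin n))) : Prop :=
  ∃ k : ℝ, 0 < k ∧ ∀ x ∈ K, ∀ y ∈ K,
    Metric.ball (midpoint ℝ x y) (k * ‖x - y‖ ^ 2) ⊆ K

/-- A uniformly elliptic integrand: one-homogeneous, positive and smooth away from the origin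
(equivalently, on the unit sphere), with uniformly convex unit sublevel set. -/
structure IsUniformlyEllipticIntegrand {n : ℕ} (Φ : EuclideanSpace ℝ (Fin n) → ℝ) : Prop where
  homogeneous : ∀ t : ℝ, 0 ≤ t → ∀ z, Φ (t • z) = t * Φ z
  pos : ∀ z, z ≠ 0 → 0 < Φ z
  smooth : ContDiffOn ℝ (⊤ : ℕ∞) Φ {z | z ≠ 0}
  uniformlyConvex : IsUniformlyConvexSet {z | Φ z < 1}

/-- The integrand on `ℝ⁴ = ℝ² × ℝ²` built from a function `φ` of one variable:
`(x, y) ↦ |y| φ(|x| / |y|)` where `y ≠ 0`, and `(x, y) ↦ |x| φ(|y| / |x|)` where `y = 0`. -/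
def psiBar (φ : ℝ → ℝ) (z : EuclideanSpace ℝ (Fin 4)) : ℝ :=
  let normX := Real.sqrt (z 0 ^ 2 + z 1 ^ 2)
  let normY := Real.sqrt (z 2 ^ 2 + z 3 ^ 2)
  if normY = 0 then normX * φ (normY / normX) else normY * φ (normX / normY)

/-! ### The nonlinear ordinary differential operator -/

/-- `P(s) = φ'(s) / φ''(s)`. -/
def coeffP (φ : ℝ → ℝ) (s : ℝ) : ℝ := deriv φ s / deriv (deriv φ) s

/-- `Q(s) = (s φ'(s) - φ(s)) / φ''(s)`. -/
def coeffQ (φ : ℝ → ℝ) (s : ℝ) : ℝ := (s * deriv φ s - φ s) / deriv (deriv φ) s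

/-- The quotient `h(τ) / τ`, for a differentiable function with `h(0) = 0`, continued to `τ = 0` by
its limit `h'(0)`. -/
def divByVar (h : ℝ → ℝ) (τ : ℝ) : ℝ := if τ = 0 then deriv h 0 else h τ / τ

/-- `G(s)(τ) = s''(τ) + P(s'(τ)) / τ + Q(s'(τ)) / s(τ)`, the second term being continued to
`τ = 0` by its limit. -/
def opG (φ s : ℝ → ℝ) (τ : ℝ) : ℝ :=
  deriv (deriv s) τ + divByVar (fun t => coeffP φ (deriv s t)) τ + coeffQ φ (deriv s τ) / s τ

/-! ### The profile of the leaves of the foliation -/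

/-- Uniform convexity on every bounded interval (for `C²` functions: positive second derivative). -/
def LocallyUniformlyConvex (f : ℝ → ℝ) : Prop :=
  ∀ R : ℝ, 0 < R → ∃ m : ℝ, 0 < m ∧ StrongConvexOn (Set.Icc (-R) R) m f

/-- `φ` generates an integrand on `ℝ⁴`: it is even and analytic, the two formulas
`|y| φ(|x| / |y|)` and `|x| φ(|y| / |x|)` agree where both make sense, and the function that they
define is a uniformly elliptic integrand. -/
structure IsGenerator (φ : ℝ → ℝ) : Prop where
  even : ∀ s, φ (-s) = φ s
  analytic : AnalyticOnNhd ℝ φ Set.univ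
  symmetric : ∀ s, 0 < s → φ s = s * φ (1 / s)
  elliptic : IsUniformlyEllipticIntegrand (psiBar φ)

/-- `σ` is the profile of a critical hypersurface `{|y| = σ(|x|)}` of the integrand generated by
`φ`, asymptotic to the cone `{|x| = |y|}` at the rate given by the exponent `μ`. -/
structure IsLeafProfile (μ : ℝ) (φ σ : ℝ → ℝ) : Prop where
  even : ∀ τ, σ (-τ) = σ τ
  analytic : AnalyticOnNhd ℝ σ Set.univ
  convex : LocallyUniformlyConvex σ
  above_cone : ∀ τ, |τ| < σ τ
  at_zero : σ 0 = 1
  equation : ∀ τ, opG φ σ τ = 0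
  asymptotics : ∃ a : ℝ, 0 < a ∧
    (fun τ : ℝ => σ τ - (τ + a * τ ^ (-μ))) =o[Filter.atTop] (fun τ : ℝ => τ ^ (-μ))

/-! ### The linearized equation and its solution -/

/-- The linearization of `opG φ` at `σ`:
`L f = f'' + (1/τ + σ'/σ + σ'' φ'''(σ')/φ''(σ')) f' + (φ(σ') - σ' φ'(σ')) / (σ² φ''(σ')) f`,
the term `f'(τ) / τ` being continued to `τ = 0` by its limit. -/
def opL (φ σ f : ℝ → ℝ) (τ : ℝ) : ℝ :=
  deriv (deriv f) τ + divByVar (deriv f) τ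
    + (deriv σ τ / σ τ
        + deriv (deriv σ) τ * deriv (deriv (deriv φ)) (deriv σ τ)
          / deriv (deriv φ) (deriv σ τ)) * deriv f τ
    + (φ (deriv σ τ) - deriv σ τ * deriv φ (deriv σ τ))
        / (σ τ ^ 2 * deriv (deriv φ) (deriv σ τ)) * f τ

/-- `p(τ) = τ σ(τ) φ''(σ'(τ))`. -/
def weightP (φ σ : ℝ → ℝ) (τ : ℝ) : ℝ := τ * σ τ * deriv (deriv φ) (deriv σ τ)

/-- `f₀ = σ - τ σ'`, a solution of the homogeneous linearized equation. -/
def f0 (σ : ℝ → ℝ) (τ : ℝ) : ℝ := σ τ - τ * deriv σ τ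

/-- `f₁(τ) = f₀(τ) ∫₀^τ (f₀(t)² p(t))⁻¹ ∫₀^t σ(s)^(-5/2) p(s) f₀(s) ds dt`, the solution of
`L f = σ^(-5/2)`, `f(0) = f'(0) = 0`. -/
def f1 (φ σ : ℝ → ℝ) (τ : ℝ) : ℝ :=
  f0 σ τ * ∫ t in (0 : ℝ)..τ, 1 / (f0 σ t ^ 2 * weightP φ σ t) *
    ∫ s in (0 : ℝ)..t, σ s ^ (-(5 / 2) : ℝ) * weightP φ σ s * f0 σ s

/-! ### Asymptotic expansions -/

/-- `r` is an error term of type `𝓕(h)` with constant `c⁻¹`: it is smooth on `(0, ∞)`, and on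
`[1, ∞)` its derivatives of order at most two are bounded by `c⁻¹` times those of `h`. -/
def IsErrorTerm (c : ℝ) (h r : ℝ → ℝ) : Prop :=
  ContDiffOn ℝ (⊤ : ℕ∞) r (Set.Ioi 0) ∧
    ∀ τ : ℝ, 1 ≤ τ →
      |r τ| ≤ c⁻¹ * |h τ| ∧
      |deriv r τ| ≤ c⁻¹ * |deriv h τ| ∧
      |deriv (deriv r) τ| ≤ c⁻¹ * |deriv (deriv h) τ|

/-- `s = τ + a τ^(-μ) + 𝓕(τ^(-1/2))` on `(0, ∞)` for some `a > 0`. -/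
def HasConicalExpansion (μ c : ℝ) (s : ℝ → ℝ) : Prop :=
  ∃ a : ℝ, 0 < a ∧ ∃ r : ℝ → ℝ,
    IsErrorTerm c (fun τ : ℝ => τ ^ (-(1 / 2) : ℝ)) r ∧
      ∀ τ : ℝ, 0 < τ → s τ = τ + a * τ ^ (-μ) + r τ

end

/-!
Everything happens at the cone `σ = τ`. Since `φ(s) = s φ(1/s)`, one has `φ'(1) = φ(1) / 2`, so that
`P(1) = -Q(1) = μ (1 - μ)` and `P'(1) + Q'(1) = 2`. Hence the linearization of the equation at the
cone is the Euler operator `u'' + 2 u' / τ + μ (1 - μ) u / τ²`, with decaying solutions `τ ^ (-μ)` and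
`τ ^ (μ - 1)`. Because `μ < 1/2`, a solution whose right hand side is `O(τ ^ (-5/2))` has the form
`b τ ^ (-μ) + O(τ ^ (-1/2))`, also after two differentiations (`exists_expandsAtTop`; the property is
called `ExpandsAtTop`).

This is applied twice. Convexity turns `σ - τ = O(τ ^ (-μ))` into `σ' - 1 = O(τ ^ (-μ - 1))`, so
`σ - τ` solves the Euler equation up to a quadratic error `O(τ ^ (-3 - 2 μ))`
(`IsLeafProfile.exists_expandsAtTop`). The function `f₁` comes from reduction of order: `L f₀ = 0`
because `f₀` generates the dilations of the profile, and `p f₀² (f₁ / f₀)'` is the inner integral in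
the definition of `f₁` (`IsLeafProfile.opL_f1`). The double integral then shows that `f₁ / f₀` is
bounded, and `L` differs from the Euler operator by lower order terms
(`IsLeafProfile.exists_expandsAtTop_f1`). Near the axis, dividing the inner integral by the square
of its upper limit exhibits `f₁` as a smooth even function.

The leading coefficient of `σ - τ` is positive. So the quantities `σ - |τ|`, `f₀` and `σ''`, which are
positive everywhere, are bounded below by multiples of `σ ^ (-μ)`, `σ ^ (-μ)` and `σ ^ (-μ - 2)`,
while `f₁` and `f₁''` are bounded above by such multiples, and all inequalities that are strict for
`σ` survive for `σ ± ε f₁` with small `ε`. The operator changes by `± ε σ ^ (-5/2)` up to a remainder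
of size `ε² σ ^ (-3 - 2 μ)`, which is smaller than the linear term
(`IsLeafProfile.exists_abs_opG_sub_le`).

Ellipticity enters only through `φ'' > 0`, which `IsGenerator.deriv_deriv_pos` extracts from the
uniform convexity of the sublevel set.
-/

open Set Filter Topology Asymptotics MeasureTheory

/-! ### Calculus of one variable -/

theorem contDiff_one_deriv {f : ℝ → ℝ} (hf : ContDiff ℝ 2 f) : ContDiff ℝ 1 (deriv f) := by
  have h : ContDiff ℝ (1 + 1) f := by rwa [one_add_one_eq_two]
  exact (contDiff_succ_iff_deriv.1 h).2.2

/-- First order Taylor formula with a (non-sharp) quadratic remainder. -/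
theorem abs_sub_taylor_one_le {f : ℝ → ℝ} (hf : ContDiff ℝ 2 f) {R M : ℝ}
    (hM : ∀ x ∈ Icc (-R) R, |deriv (deriv f) x| ≤ M) {z w : ℝ} (hz : z ∈ Icc (-R) R)
    (hw : w ∈ Icc (-R) R) : |f w - f z - deriv f z * (w - z)| ≤ M * (w - z) ^ 2 := by
  have hf1 : ContDiff ℝ 1 (deriv f) := contDiff_one_deriv hf
  have hd : Differentiable ℝ f := hf.differentiable (by norm_num)
  have hd1 : Differentiable ℝ (deriv f) := hf1.differentiable (by norm_num)
  have hsub : uIcc z w ⊆ Icc (-R) R := ordConnected_Icc.uIcc_subset hz hw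
  have h1 : ∀ x ∈ uIcc z w, |deriv f x - deriv f z| ≤ M * |w - z| := by
    intro x hx
    have h := (convex_Icc (-R) R).norm_image_sub_le_of_norm_deriv_le (fun y _ => hd1 y) hM hz
      (hsub hx)
    refine h.trans ?_
    have hM0 : 0 ≤ M := (abs_nonneg _).trans (hM z hz)
    exact mul_le_mul_of_nonneg_left (abs_sub_left_of_mem_uIcc hx) hM0
  have h2 : ∀ x, HasDerivAt (fun x => f x - deriv f z * (x - z)) (deriv f x - deriv f z) x := by
    intro x
    exact ((hd x).hasDerivAt.fun_sub
      (((hasDerivAt_id' x).sub_const z).const_mul (deriv f z))).congr_deriv (by ring)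
  have h3 := (convex_uIcc z w).norm_image_sub_le_of_norm_hasDerivWithin_le
    (fun x _ => (h2 x).hasDerivWithinAt) h1 left_mem_uIcc right_mem_uIcc
  simp only [Real.norm_eq_abs, sub_self, mul_zero, sub_zero] at h3
  calc _ = |f w - deriv f z * (w - z) - f z| := by ring_nf
    _ ≤ _ := h3
    _ = M * (w - z) ^ 2 := by rw [mul_assoc, abs_mul_abs_self]; ring

theorem hasDerivAt_integral_pow_mul_comp_mul {g : ℝ → ℝ} (hg : ContDiff ℝ 1 g) (k : ℕ) (t : ℝ) :
    HasDerivAt (fun t => ∫ u in (0 : ℝ)..1, u ^ k * g (t * u))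
      (∫ u in (0 : ℝ)..1, u ^ (k + 1) * deriv g (t * u)) t := by
  have hg' : Continuous (deriv g) := hg.continuous_deriv le_rfl
  have hd : Differentiable ℝ g := hg.differentiable (by norm_num)
  have hc := hg.continuous
  obtain ⟨M, hM⟩ := (isCompact_Icc (a := -(|t| + 1)) (b := |t| + 1)).exists_bound_of_continuousOn
    hg'.continuousOn
  refine (intervalIntegral.hasDerivAt_integral_of_dominated_loc_of_deriv_le
    (F := fun t u => u ^ k * g (t * u)) (F' := fun t u => u ^ (k + 1) * deriv g (t * u))
    (bound := fun _ => M) (Metric.ball_mem_nhds t one_pos) ?_ ?_ ?_ ?_ ?_ ?_).2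
  · exact Eventually.of_forall fun x => (by fun_prop : Continuous _).aestronglyMeasurable
  · exact (by fun_prop : Continuous _).intervalIntegrable _ _
  · exact (by fun_prop : Continuous _).aestronglyMeasurable
  · refine Eventually.of_forall fun u hu x hx => ?_
    rw [uIoc_of_le zero_le_one] at hu
    have hx' : |x| ≤ |t| + 1 := by
      have h1 : |x - t| < 1 := by simpa [Real.dist_eq] using hx
      have h2 := abs_add_le (x - t) t
      simp only [sub_add_cancel] at h2
      linarith
    have hxu : |x * u| ≤ |t| + 1 := by
      rw [abs_mul, abs_of_pos hu.1]
      exact (mul_le_of_le_one_right (abs_nonneg x) hu.2).trans hx'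
    rw [norm_mul]
    have h1 : ‖u ^ (k + 1)‖ ≤ 1 := by
      rw [norm_pow, Real.norm_eq_abs, abs_of_pos hu.1]
      exact pow_le_one₀ hu.1.le hu.2
    exact (mul_le_of_le_one_left (norm_nonneg _) h1).trans (hM _ (abs_le.1 hxu))
  · simp
  · refine Eventually.of_forall fun u _ x _ => ?_
    have h1 : HasDerivAt (fun x : ℝ => x * u) u x := by
      simpa using (hasDerivAt_id x).mul_const u
    exact (((hd (x * u)).hasDerivAt.comp x h1).const_mul (u ^ k)).congr_deriv (by ring)

/-- Differentiation under the integral raises the power of `u`, which keeps the family closed. -/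
theorem contDiff_integral_pow_mul_comp_mul {g : ℝ → ℝ} (hg : ContDiff ℝ (⊤ : ℕ∞) g) (k : ℕ) :
    ContDiff ℝ (⊤ : ℕ∞) (fun t => ∫ u in (0 : ℝ)..1, u ^ k * g (t * u)) := by
  rw [contDiff_infty]
  intro n
  induction n generalizing g k with
  | zero =>
    have h : Differentiable ℝ (fun t => ∫ u in (0 : ℝ)..1, u ^ k * g (t * u)) := fun t =>
      (hasDerivAt_integral_pow_mul_comp_mul (hg.of_le (mod_cast le_top)) k t).differentiableAt
    exact contDiff_zero.2 h.continuous
  | succ n ih =>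
    have h := hasDerivAt_integral_pow_mul_comp_mul (hg.of_le (mod_cast le_top)) k
    push_cast
    refine contDiff_succ_iff_deriv.2 ⟨fun t => (h t).differentiableAt, by simp, ?_⟩
    rw [show deriv _ = _ from funext fun t => (h t).deriv]
    exact ih (contDiff_infty_iff_deriv.1 hg).2 (k + 1)

/-- With the previous lemma: a primitive of `s g(s)` vanishing at `0` is `t²` times a smooth
function. -/
theorem integral_mul_eq_sq_mul_integral {g : ℝ → ℝ} (t : ℝ) :
    ∫ s in (0 : ℝ)..t, s * g s = t ^ 2 * ∫ u in (0 : ℝ)..1, u ^ 1 * g (t * u) := by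
  have h := intervalIntegral.mul_integral_comp_mul_left (a := 0) (b := 1)
    (f := fun s => s * g s) t
  simp only [mul_zero, mul_one] at h
  rw [← h, ← intervalIntegral.integral_const_mul, ← intervalIntegral.integral_const_mul]
  congr 1
  ext u
  ring

/-- The difference of the two sides has a strict local minimum, by the second derivative test. -/
theorem eventually_le_quadratic {f : ℝ → ℝ} (hf : ContDiff ℝ 2 f) {x δ : ℝ}
    (hx : deriv (deriv f) x ≤ 0) (hδ : 0 < δ) :
    ∀ᶠ y in 𝓝 x, f y ≤ f x + deriv f x * (y - x) + δ * (y - x) ^ 2 := by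
  have hf1 : ContDiff ℝ 1 (deriv f) := contDiff_one_deriv hf
  have hd : Differentiable ℝ f := hf.differentiable (by norm_num)
  have hd1 : Differentiable ℝ (deriv f) := hf1.differentiable (by norm_num)
  set g : ℝ → ℝ := fun y => f x + deriv f x * (y - x) + δ * (y - x) ^ 2 - f y with hg
  have h1 : ∀ y, HasDerivAt g (deriv f x + δ * (2 * (y - x)) - deriv f y) y := by
    intro y
    have h0 : HasDerivAt (fun y => y - x) 1 y := (hasDerivAt_id y).sub_const x
    exact ((((h0.const_mul (deriv f x)).const_add (f x)).fun_add
      ((h0.fun_pow 2).const_mul δ)).fun_sub (hd y).hasDerivAt).congr_deriv (by norm_num)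
  have h1' : deriv g = fun y => deriv f x + δ * (2 * (y - x)) - deriv f y :=
    funext fun y => (h1 y).deriv
  have h2 : HasDerivAt (deriv g) (2 * δ - deriv (deriv f) x) x := by
    rw [h1']
    have h0 : HasDerivAt (fun y => y - x) 1 x := (hasDerivAt_id x).sub_const x
    exact (((((h0.const_mul 2).const_mul δ)).const_add (deriv f x)).fun_sub
      (hd1 x).hasDerivAt).congr_deriv (by ring)
  have hmin := isLocalMin_of_deriv_deriv_pos (f := g) (x₀ := x) (by rw [h2.deriv]; linarith)
    (by rw [h1']; simp) (h1 x).continuousAt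
  filter_upwards [hmin] with y hy
  simp only [hg, sub_self, mul_zero, add_zero] at hy
  norm_num at hy
  linarith

/-! ### Powers as comparison functions at infinity -/

theorem isBigO_rpow_mul {f g : ℝ → ℝ} {a b c : ℝ} (hf : f =O[atTop] fun t : ℝ => t ^ a)
    (hg : g =O[atTop] fun t : ℝ => t ^ b) (h : a + b = c) :
    (fun t => f t * g t) =O[atTop] fun t : ℝ => t ^ c := by
  refine (hf.mul hg).congr' EventuallyEq.rfl ?_
  filter_upwards [eventually_gt_atTop 0] with t ht
  rw [← Real.rpow_add ht, h]

theorem isBigO_rpow_rpow {a b : ℝ} (h : a ≤ b) :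
    (fun t : ℝ => t ^ a) =O[atTop] fun t : ℝ => t ^ b := by
  refine IsBigO.of_bound 1 ?_
  filter_upwards [eventually_ge_atTop 1] with t ht
  have h0 : (0 : ℝ) ≤ t := by linarith
  rw [one_mul, Real.norm_of_nonneg (Real.rpow_nonneg h0 _),
    Real.norm_of_nonneg (Real.rpow_nonneg h0 _)]
  exact Real.rpow_le_rpow_of_exponent_le ht h

theorem isBigO_rpow_of_le {f : ℝ → ℝ} {a b : ℝ} (hf : f =O[atTop] fun t : ℝ => t ^ a)
    (h : a ≤ b) : f =O[atTop] fun t : ℝ => t ^ b := hf.trans (isBigO_rpow_rpow h)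

theorem isBigO_const_rpow (c : ℝ) {b : ℝ} (h : 0 ≤ b) :
    (fun _ : ℝ => c) =O[atTop] fun t : ℝ => t ^ b := by
  have h1 : (fun _ : ℝ => c) =O[atTop] fun t : ℝ => t ^ (0 : ℝ) := by
    simpa using isBigO_const_const c (one_ne_zero' ℝ) atTop
  exact isBigO_rpow_of_le h1 h

theorem isBigO_self_rpow : (fun t : ℝ => t) =O[atTop] fun t : ℝ => t ^ (1 : ℝ) := by
  simpa using isBigO_refl (fun t : ℝ => t) atTop

theorem isBigO_inv_rpow : (fun t : ℝ => t⁻¹) =O[atTop] fun t : ℝ => t ^ (-1 : ℝ) := by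
  simpa [Real.rpow_neg_one] using isBigO_refl (fun t : ℝ => t⁻¹) atTop

/-- A power bound for the derivative, integrated; the exponent `a` may have either sign. -/
theorem exists_bound_of_deriv_isBigO {f f' : ℝ → ℝ} {a : ℝ}
    (hf : ∀ t, 0 < t → HasDerivAt f (f' t) t) (ha : a ≠ 0)
    (h : f' =O[atTop] fun t : ℝ => t ^ (a - 1)) :
    ∃ C N : ℝ, 0 < N ∧ ∀ s t, N ≤ s → s ≤ t → |f t - f s| ≤ C / a * (t ^ a - s ^ a) := by
  obtain ⟨C, hC⟩ := h.bound
  obtain ⟨N, hN⟩ := eventually_atTop.1 hC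
  refine ⟨C, max N 1, by positivity, fun s t hs hst => ?_⟩
  have hs0 : 0 < s := lt_of_lt_of_le one_pos ((le_max_right _ _).trans hs)
  have hB : ∀ x ∈ Icc s t, HasDerivAt (fun x => C / a * (x ^ a - s ^ a)) (C * x ^ (a - 1)) x := by
    intro x hx
    exact (((Real.hasDerivAt_rpow_const (p := a) (Or.inl (hs0.trans_le hx.1).ne')).sub_const
      (s ^ a)).const_mul (C / a)).congr_deriv (by rw [← mul_assoc, div_mul_cancel₀ _ ha])
  have hf2 : ∀ x ∈ Icc s t, HasDerivAt (fun x => f x - f s) (f' x) x := fun x hx =>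
    (hf x (hs0.trans_le hx.1)).sub_const _
  refine image_norm_le_of_norm_deriv_right_le_deriv_boundary' (f := fun x => f x - f s) (f' := f')
    (fun x hx => (hf2 x hx).continuousAt.continuousWithinAt)
    (fun x hx => (hf2 x (Ico_subset_Icc_self hx)).hasDerivWithinAt)
    (by simp)
    (fun x hx => (hB x hx).continuousAt.continuousWithinAt)
    (fun x hx => (hB x (Ico_subset_Icc_self hx)).hasDerivWithinAt) ?_ (right_mem_Icc.2 hst)
  intro x hx
  have hx0 : 0 < x := hs0.trans_le hx.1
  have := hN x ((le_max_left _ _).trans (hs.trans hx.1))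
  rwa [Real.norm_of_nonneg (Real.rpow_nonneg hx0.le _)] at this

theorem isBigO_of_deriv_isBigO_of_pos {f f' : ℝ → ℝ} {a : ℝ}
    (hf : ∀ t, 0 < t → HasDerivAt f (f' t) t) (ha : 0 < a)
    (h : f' =O[atTop] fun t : ℝ => t ^ (a - 1)) : f =O[atTop] fun t : ℝ => t ^ a := by
  obtain ⟨C, N, hN, hb⟩ := exists_bound_of_deriv_isBigO hf ha.ne' h
  have h1 : (fun t => f t - f N) =O[atTop] fun t : ℝ => t ^ a := by
    refine IsBigO.of_bound (|C / a|) ?_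
    filter_upwards [eventually_ge_atTop N] with t ht
    have ht0 : 0 < t := hN.trans_le ht
    rw [Real.norm_of_nonneg (Real.rpow_nonneg ht0.le _)]
    have h2 : N ^ a ≤ t ^ a := Real.rpow_le_rpow hN.le ht ha.le
    have h3 : 0 ≤ N ^ a := Real.rpow_nonneg hN.le _
    refine (hb N t le_rfl ht).trans ?_
    refine (mul_le_mul_of_nonneg_right (le_abs_self _) (by linarith)).trans ?_
    exact mul_le_mul_of_nonneg_left (by linarith) (abs_nonneg _)
  simpa using h1.add (isBigO_const_rpow (f N) ha.le)

theorem exists_sub_isBigO_of_deriv_isBigO_of_neg {f f' : ℝ → ℝ} {a : ℝ}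
    (hf : ∀ t, 0 < t → HasDerivAt f (f' t) t) (ha : a < 0)
    (h : f' =O[atTop] fun t : ℝ => t ^ (a - 1)) :
    ∃ l, (fun t => f t - l) =O[atTop] fun t : ℝ => t ^ a := by
  obtain ⟨C, N, hN, hb⟩ := exists_bound_of_deriv_isBigO hf ha.ne h
  have hb' : ∀ s t, N ≤ s → s ≤ t → |f t - f s| ≤ |C / a| * s ^ a := by
    intro s t hs hst
    have hs0 : 0 < s := hN.trans_le hs
    have h3 : 0 ≤ t ^ a := Real.rpow_nonneg (hs0.le.trans hst) _
    have h4 : t ^ a ≤ s ^ a := Real.rpow_le_rpow_of_nonpos hs0 hst ha.le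
    refine (hb s t hs hst).trans ?_
    rw [← neg_mul_neg]
    refine (mul_le_mul_of_nonneg_right (neg_le_abs _) (by linarith)).trans ?_
    exact mul_le_mul_of_nonneg_left (by linarith) (abs_nonneg _)
  have hlim : Tendsto (fun s : ℝ => |C / a| * s ^ a) atTop (𝓝 0) := by
    have := (tendsto_rpow_neg_atTop (y := -a) (by linarith)).const_mul (|C / a|)
    simpa using this
  have hcau : Cauchy (map f atTop) := by
    rw [Metric.cauchy_iff]
    refine ⟨inferInstance, fun ε hε => ?_⟩
    obtain ⟨M, hM⟩ := eventually_atTop.1 ((hlim.eventually (gt_mem_nhds (half_pos hε))).and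
      (eventually_ge_atTop N))
    refine ⟨f '' Ici M, image_mem_map (Ici_mem_atTop M), ?_⟩
    rintro _ ⟨x, hx, rfl⟩ _ ⟨y, hy, rfl⟩
    have hMM := hM M le_rfl
    have h1 := hb' M x hMM.2 hx
    have h2 := hb' M y hMM.2 hy
    rw [Real.dist_eq]
    have h3 := abs_sub_le (f x) (f M) (f y)
    rw [abs_sub_comm (f M)] at h3
    linarith [hMM.1]
  obtain ⟨l, hl⟩ := CompleteSpace.complete hcau
  have hl' : Tendsto f atTop (𝓝 l) := hl
  refine ⟨l, IsBigO.of_bound (|C / a|) ?_⟩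
  filter_upwards [eventually_ge_atTop N] with s hs
  rw [Real.norm_of_nonneg (Real.rpow_nonneg (hN.le.trans hs) _), Real.norm_eq_abs, abs_sub_comm]
  refine le_of_tendsto ((hl'.sub_const (f s)).abs) ?_
  filter_upwards [eventually_ge_atTop s] with t ht
  exact hb' s t hs ht

/-- A bound at infinity between continuous functions is global if `|f|` and `g` are even and `g` is
positive. -/
theorem exists_pos_forall_abs_le_of_isBigO {f g : ℝ → ℝ} (hf : Continuous f) (hg : Continuous g)
    (hg0 : ∀ t, 0 < g t) (hfe : ∀ t, |f (-t)| = |f t|) (hge : ∀ t, g (-t) = g t)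
    (h : f =O[atTop] g) : ∃ C, 0 < C ∧ ∀ t, |f t| ≤ C * g t := by
  obtain ⟨C, hC⟩ := h.bound
  obtain ⟨N, hN⟩ := eventually_atTop.1 hC
  obtain ⟨K, hK⟩ := (isCompact_Icc (a := 0) (b := N)).exists_bound_of_continuousOn
    (f := fun t => f t / g t) (hf.div hg fun t => (hg0 t).ne').continuousOn
  refine ⟨max (max C K) 1, by positivity, ?_⟩
  have key : ∀ t, 0 ≤ t → |f t| ≤ max (max C K) 1 * g t := by
    intro t ht
    rcases le_total t N with h1 | h1
    · have := hK t ⟨ht, h1⟩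
      rw [norm_div, Real.norm_of_nonneg (hg0 t).le, div_le_iff₀ (hg0 t)] at this
      exact this.trans (mul_le_mul_of_nonneg_right ((le_max_right _ _).trans (le_max_left _ _))
        (hg0 t).le)
    · have := hN t h1
      rw [Real.norm_of_nonneg (hg0 t).le] at this
      exact this.trans (mul_le_mul_of_nonneg_right ((le_max_left _ _).trans (le_max_left _ _))
        (hg0 t).le)
  intro t
  rcases le_total 0 t with ht | ht
  · exact key t ht
  · have := key (-t) (by linarith)
    rwa [hfe, hge] at this

/-! ### The generating function -/

/-- The point `((x, 0), (y, 0))` of `ℝ² × ℝ² = ℝ⁴`. -/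
noncomputable def planePoint (x y : ℝ) : EuclideanSpace ℝ (Fin 4) := !₂[x, 0, y, 0]

theorem IsGenerator.psiBar_planePoint {φ : ℝ → ℝ} (hφ : IsGenerator φ) {x y : ℝ} (hy : 0 < y) :
    psiBar φ (planePoint x y) = y * φ (x / y) := by
  have h1 : φ (|x| / y) = φ (x / y) := by
    rcases abs_choice x with h | h <;> rw [h]
    rw [neg_div, hφ.even]
  simp [psiBar, planePoint, Real.sqrt_sq hy.le, hy.ne', Real.sqrt_sq_eq_abs, h1]

theorem smul_planePoint (c x y : ℝ) : c • planePoint x y = planePoint (c * x) (c * y) := by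
  ext i
  fin_cases i <;> simp [planePoint]

theorem planePoint_add (x y x' y' : ℝ) :
    planePoint x y + planePoint x' y' = planePoint (x + x') (y + y') := by
  ext i
  fin_cases i <;> simp [planePoint]

theorem planePoint_ne_zero {x y : ℝ} (h : y ≠ 0 ∨ x ≠ 0) : planePoint x y ≠ 0 := by
  intro h0
  have h1 := congrArg (fun v => v 0) h0
  have h2 := congrArg (fun v => v 2) h0
  simp [planePoint] at h1 h2
  tauto

theorem IsGenerator.pos {φ : ℝ → ℝ} (hφ : IsGenerator φ) (s : ℝ) : 0 < φ s := by
  have h := hφ.elliptic.pos (planePoint s 1) (planePoint_ne_zero (Or.inl one_ne_zero))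
  rw [hφ.psiBar_planePoint one_pos] at h
  simpa using h

theorem IsGenerator.contDiff {φ : ℝ → ℝ} (hφ : IsGenerator φ) : ContDiff ℝ (⊤ : ℕ∞) φ :=
  hφ.analytic.contDiff

/-- On the tangent line `z + t e` of the unit sphere of the integrand at `z = (s, 1) / φ s`, the
integrand exceeds `1` by only `o(t²)` if `φ'' s ≤ 0`. The points at the parameters `± t`, scaled into
the sublevel set, then have a midpoint too close to its boundary. -/
theorem IsGenerator.deriv_deriv_pos {φ : ℝ → ℝ} (hφ : IsGenerator φ) (s : ℝ) :
    0 < deriv (deriv φ) s := by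
  by_contra! hle
  obtain ⟨k, hk, hball⟩ := hφ.elliptic.uniformlyConvex
  have hF := hφ.pos s
  set F := φ s with hFdef
  set D := deriv φ s with hD
  set z := planePoint (s / F) (1 / F) with hz
  set e := planePoint (F - s * D) (-D) with he
  have hz0 : 0 < ‖z‖ := norm_pos_iff.2 (planePoint_ne_zero (Or.inl (by positivity)))
  have he0 : 0 < ‖e‖ := by
    refine norm_pos_iff.2 (planePoint_ne_zero ?_)
    by_cases h : D = 0
    · right; simp [h, hF.ne']
    · left; simpa using h
  set δ := k * ‖e‖ ^ 2 / (3 * ‖z‖ * F ^ 3) with hδ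
  have hδ0 : 0 < δ := by positivity
  have hquad := eventually_le_quadratic (contDiff_infty.1 hφ.contDiff 2) hle hδ0
  -- the slope coordinate of the point of parameter `t` on the tangent line
  set S : ℝ → ℝ := fun t => s + t * F ^ 2 / (1 - t * F * D) with hS
  have hS0 : Tendsto S (𝓝 0) (𝓝 s) := by
    have : ContinuousAt S 0 := by
      refine continuousAt_const.add (ContinuousAt.div (by fun_prop) (by fun_prop) (by simp))
    simpa [ContinuousAt, hS] using this
  have hden : ∀ᶠ t in 𝓝 (0 : ℝ), 1 / 2 < 1 - t * F * D := by
    have : ContinuousAt (fun t : ℝ => 1 - t * F * D) 0 := by fun_prop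
    exact this.eventually (lt_mem_nhds (by norm_num))
  have hM4 : ∀ᶠ t in 𝓝 (0 : ℝ), 1 + 3 * δ * F ^ 3 * t ^ 2 < 4 := by
    have : ContinuousAt (fun t : ℝ => 1 + 3 * δ * F ^ 3 * t ^ 2) 0 := by fun_prop
    exact this.eventually (gt_mem_nhds (by norm_num))
  have hline : ∀ᶠ t in 𝓝 (0 : ℝ), psiBar φ (z + t • e) ≤ 1 + 2 * δ * F ^ 3 * t ^ 2 := by
    filter_upwards [hS0.eventually hquad, hden] with t h1 h2
    have hd0 : 0 < 1 - t * F * D := by linarith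
    have h3 : z + t • e = planePoint (s / F + t * (F - s * D)) ((1 - t * F * D) / F) := by
      rw [hz, he, smul_planePoint, planePoint_add]
      congr 1
      field_simp
      ring
    have h4 : (s / F + t * (F - s * D)) / ((1 - t * F * D) / F) = S t := by
      have hd1 : 1 - t * F * D ≠ 0 := hd0.ne'
      simp only [hS]
      rw [div_eq_iff (by positivity), add_mul, div_mul_div_comm, mul_comm (1 - t * F * D) F,
        mul_div_mul_right _ _ hd1]
      field_simp
      ring
    rw [h3, hφ.psiBar_planePoint (by positivity), h4]
    have h5 : S t - s = t * F ^ 2 / (1 - t * F * D) := by rw [hS]; ring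
    rw [h5] at h1
    calc (1 - t * F * D) / F * φ (S t) ≤ (1 - t * F * D) / F * (F +
          D * (t * F ^ 2 / (1 - t * F * D)) + δ * (t * F ^ 2 / (1 - t * F * D)) ^ 2) :=
          mul_le_mul_of_nonneg_left h1 (by positivity)
      _ = 1 + δ * F ^ 3 * t ^ 2 * (1 - t * F * D)⁻¹ := by
          field_simp
          ring
      _ ≤ 1 + δ * F ^ 3 * t ^ 2 * 2 := by
          gcongr
          rw [inv_le_comm₀ hd0 two_pos]
          linarith
      _ = _ := by ring
  have hneg : Tendsto (fun t : ℝ => -t) (𝓝 0) (𝓝 0) := by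
    simpa using (continuous_neg (G := ℝ)).tendsto 0
  have hall := (hline.and ((hneg.eventually hline).and hM4))
  obtain ⟨t, ⟨ht1, ht2, ht3⟩, ht0⟩ :=
    ((hall.filter_mono nhdsWithin_le_nhds).and
      (self_mem_nhdsWithin (a := (0 : ℝ)) (s := {0}ᶜ))).exists
  replace ht0 : t ≠ 0 := ht0
  set M := 1 + 3 * δ * F ^ 3 * t ^ 2 with hM
  have ht2' : 0 < t ^ 2 := by positivity
  have hM0 : 0 < M := by positivity
  have hmem : ∀ r : ℝ, psiBar φ (z + r • e) ≤ 1 + 2 * δ * F ^ 3 * t ^ 2 →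
      (1 / M) • (z + r • e) ∈ {z | psiBar φ z < 1} := by
    intro r hr
    have hp : 0 < δ * F ^ 3 * t ^ 2 := by positivity
    rw [mem_ofPred_eq, hφ.elliptic.homogeneous _ (by positivity), one_div_mul_eq_div, div_lt_one hM0]
    linarith
  -- the point `(1 + ρ) z / M` stays in the ball around the midpoint `z / M`, as `M < 4`
  set ρ := k * t ^ 2 * ‖e‖ ^ 2 / ‖z‖ with hρ
  have hsub := hball _ (hmem t ht1) _ (hmem (-t) (by simpa using ht2))
  have hmid : midpoint ℝ ((1 / M) • (z + t • e)) ((1 / M) • (z + (-t) • e)) = (1 / M) • z := by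
    rw [midpoint_eq_smul_add, invOf_eq_inv]
    module
  have hdiff : (1 / M) • (z + t • e) - (1 / M) • (z + (-t) • e) = (2 * t / M) • e := by module
  rw [hmid, hdiff] at hsub
  have hp : ((1 + ρ) / M) • z ∈ {z | psiBar φ z < 1} := by
    refine hsub ?_
    have : ((1 + ρ) / M) • z - (1 / M) • z = (ρ / M) • z := by module
    have hρ0 : 0 ≤ ρ / M := by positivity
    rw [Metric.mem_ball, dist_eq_norm, this, norm_smul, norm_smul, Real.norm_of_nonneg hρ0, mul_pow,
      Real.norm_eq_abs, sq_abs, hρ]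
    have e1 : k * t ^ 2 * ‖e‖ ^ 2 / ‖z‖ / M * ‖z‖ = (k * t ^ 2 * ‖e‖ ^ 2) * (1 / M ^ 2) * M := by
      field_simp
    have e2 : k * ((2 * t / M) ^ 2 * ‖e‖ ^ 2) = (k * t ^ 2 * ‖e‖ ^ 2) * (1 / M ^ 2) * 4 := by
      field_simp
      ring
    rw [e1, e2]
    exact mul_lt_mul_of_pos_left ht3 (by positivity)
  have hz1 : psiBar φ z = 1 := by
    rw [hz, hφ.psiBar_planePoint (by positivity)]
    have : s / F / (1 / F) = s := by field_simp
    rw [this, ← hFdef]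
    field_simp
  rw [mem_ofPred_eq, hφ.elliptic.homogeneous _ (by positivity), hz1, mul_one, div_lt_one hM0] at hp
  have : ρ = 3 * δ * F ^ 3 * t ^ 2 := by
    rw [hρ, hδ]
    field_simp
  linarith

theorem IsGenerator.contDiff_deriv {φ : ℝ → ℝ} (hφ : IsGenerator φ) :
    ContDiff ℝ (⊤ : ℕ∞) (deriv φ) := (contDiff_infty_iff_deriv.1 hφ.contDiff).2

theorem IsGenerator.contDiff_deriv_deriv {φ : ℝ → ℝ} (hφ : IsGenerator φ) :
    ContDiff ℝ (⊤ : ℕ∞) (deriv (deriv φ)) := (contDiff_infty_iff_deriv.1 hφ.contDiff_deriv).2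

theorem deriv_neg_of_even {f : ℝ → ℝ} (hf : ∀ t, f (-t) = f t) (t : ℝ) :
    deriv f (-t) = -deriv f t := by
  have h := deriv_comp_neg f t
  simp only [hf] at h
  change deriv f t = _ at h
  linarith

theorem deriv_neg_of_odd {f : ℝ → ℝ} (hf : ∀ t, f (-t) = -f t) (t : ℝ) :
    deriv f (-t) = deriv f t := by
  have h := deriv_comp_neg f t
  simp only [hf] at h
  rw [deriv.fun_neg] at h
  linarith

theorem deriv_zero_of_even {f : ℝ → ℝ} (hf : ∀ t, f (-t) = f t) : deriv f 0 = 0 := by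
  have h := deriv_neg_of_even hf 0
  rw [neg_zero] at h
  linarith

theorem IsGenerator.deriv_one {φ : ℝ → ℝ} (hφ : IsGenerator φ) : deriv φ 1 = φ 1 / 2 := by
  have hd : Differentiable ℝ φ := hφ.contDiff.differentiable (by simp)
  have h1 : HasDerivAt (fun s => s * φ (1 / s)) (1 * φ (1 / 1) + 1 * (deriv φ 1 * (-1))) 1 := by
    have h2 : HasDerivAt (fun s : ℝ => 1 / s) (-1) 1 := by
      simpa using hasDerivAt_inv (one_ne_zero' ℝ)
    have h3 : HasDerivAt φ (deriv φ 1) (1 / 1) := by simpa using (hd 1).hasDerivAt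
    exact (hasDerivAt_id' 1).fun_mul (h3.comp 1 h2)
  have h4 : φ =ᶠ[𝓝 1] fun s => s * φ (1 / s) := by
    filter_upwards [lt_mem_nhds (zero_lt_one' ℝ)] with s hs using hφ.symmetric s hs
  have h5 := (h1.congr_of_eventuallyEq h4).deriv
  norm_num at h5
  linarith

theorem IsGenerator.contDiff_coeffP {φ : ℝ → ℝ} (hφ : IsGenerator φ) :
    ContDiff ℝ (⊤ : ℕ∞) (coeffP φ) :=
  hφ.contDiff_deriv.div hφ.contDiff_deriv_deriv fun s => (hφ.deriv_deriv_pos s).ne'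

theorem IsGenerator.contDiff_coeffQ {φ : ℝ → ℝ} (hφ : IsGenerator φ) :
    ContDiff ℝ (⊤ : ℕ∞) (coeffQ φ) :=
  ((contDiff_id.mul hφ.contDiff_deriv).sub hφ.contDiff).div hφ.contDiff_deriv_deriv
    fun s => (hφ.deriv_deriv_pos s).ne'

theorem IsGenerator.deriv_coeffP {φ : ℝ → ℝ} (hφ : IsGenerator φ) (s : ℝ) :
    deriv (coeffP φ) s =
      1 - deriv φ s * deriv (deriv (deriv φ)) s / deriv (deriv φ) s ^ 2 := by
  have h1 := (hφ.contDiff_deriv.differentiable (by simp) s).hasDerivAt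
  have h2 := (hφ.contDiff_deriv_deriv.differentiable (by simp) s).hasDerivAt
  have h0 := (hφ.deriv_deriv_pos s).ne'
  refine ((h1.fun_div h2 h0).congr_deriv ?_).deriv
  field_simp

theorem IsGenerator.deriv_coeffQ {φ : ℝ → ℝ} (hφ : IsGenerator φ) (s : ℝ) :
    deriv (coeffQ φ) s =
      s - (s * deriv φ s - φ s) * deriv (deriv (deriv φ)) s / deriv (deriv φ) s ^ 2 := by
  have h := (hφ.contDiff.differentiable (by simp) s).hasDerivAt
  have h1 := (hφ.contDiff_deriv.differentiable (by simp) s).hasDerivAt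
  have h2 := (hφ.contDiff_deriv_deriv.differentiable (by simp) s).hasDerivAt
  have h0 := (hφ.deriv_deriv_pos s).ne'
  refine (((((hasDerivAt_id' s).fun_mul h1).fun_sub h).fun_div h2 h0).congr_deriv ?_).deriv
  field_simp
  ring

theorem IsGenerator.coeffP_zero {φ : ℝ → ℝ} (hφ : IsGenerator φ) : coeffP φ 0 = 0 := by
  rw [coeffP, deriv_zero_of_even hφ.even, zero_div]

theorem IsGenerator.coeffP_one {φ : ℝ → ℝ} (hφ : IsGenerator φ) :
    coeffP φ 1 = φ 1 / (2 * deriv (deriv φ) 1) := by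
  rw [coeffP, hφ.deriv_one, div_div]

theorem IsGenerator.coeffQ_one {φ : ℝ → ℝ} (hφ : IsGenerator φ) :
    coeffQ φ 1 = -coeffP φ 1 := by
  rw [coeffP, coeffQ, hφ.deriv_one]
  ring

theorem IsGenerator.deriv_coeffP_add_deriv_coeffQ_one {φ : ℝ → ℝ} (hφ : IsGenerator φ) :
    deriv (coeffP φ) 1 + deriv (coeffQ φ) 1 = 2 := by
  rw [hφ.deriv_coeffP, hφ.deriv_coeffQ, hφ.deriv_one]
  ring

/-! ### Second order expansion of the operator -/

/-- The first order terms of `P(s') / τ + Q(s') / s` at `s' = z`, in the increments `h` of `z` and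
`k` of `s`, with a quadratic remainder. -/
theorem exists_abs_remainder_le {P Q : ℝ → ℝ} (hP : ContDiff ℝ 2 P) (hQ : ContDiff ℝ 2 Q) :
    ∃ C, 0 < C ∧ ∀ z h s k τ : ℝ, z ∈ Icc (-2 : ℝ) 2 → z + h ∈ Icc (-2 : ℝ) 2 → 0 < s →
      |k| ≤ s / 2 →
      |P (z + h) / τ + Q (z + h) / (s + k) - (P z / τ + Q z / s)
        - (deriv P z * h / τ + deriv Q z * h / s - Q z * k / s ^ 2)|
      ≤ C * (h ^ 2 / |τ| + h ^ 2 / s + |h| * |k| / s ^ 2 + k ^ 2 / s ^ 3) := by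
  have bd : ∀ f : ℝ → ℝ, Continuous f → ∃ M, ∀ x ∈ Icc (-2 : ℝ) 2, |f x| ≤ M := fun f hf =>
    isCompact_Icc.exists_bound_of_continuousOn hf.continuousOn
  obtain ⟨M1, h1⟩ := bd _ ((contDiff_one_deriv hP).continuous_deriv le_rfl)
  obtain ⟨M2, h2⟩ := bd _ ((contDiff_one_deriv hQ).continuous_deriv le_rfl)
  obtain ⟨M3, h3⟩ := bd _ (contDiff_one_deriv hQ).continuous
  obtain ⟨M4, h4⟩ := bd _ hQ.continuous
  set M := |M1| + |M2| + |M3| + |M4| + 1 with hM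
  have a1 := abs_nonneg M1
  have a2 := abs_nonneg M2
  have a3 := abs_nonneg M3
  have a4 := abs_nonneg M4
  have hM0 : 0 < M := by positivity
  refine ⟨2 * M, by positivity, fun z h s k τ hz hw hs hk => ?_⟩
  have hTP := abs_sub_taylor_one_le hP (M := M) (fun x hx => (h1 x hx).trans
    ((le_abs_self _).trans (by linarith))) hz hw
  have hTQ := abs_sub_taylor_one_le hQ (M := M) (fun x hx => (h2 x hx).trans
    ((le_abs_self _).trans (by linarith))) hz hw
  have hQ' : |deriv Q z| ≤ M := (h3 z hz).trans ((le_abs_self _).trans (by linarith))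
  have hQ0 : |Q z| ≤ M := (h4 z hz).trans ((le_abs_self _).trans (by linarith))
  rw [add_sub_cancel_left] at hTP hTQ
  have hsk : s / 2 ≤ s + k := by linarith [(abs_le.1 hk).1]
  have hsk0 : 0 < s + k := by linarith
  have hinv : (s + k)⁻¹ ≤ 2 / s := by
    rw [inv_le_comm₀ hsk0 (by positivity), inv_div]
    exact hsk
  have key : P (z + h) / τ + Q (z + h) / (s + k) - (P z / τ + Q z / s)
        - (deriv P z * h / τ + deriv Q z * h / s - Q z * k / s ^ 2)
      = (P (z + h) - P z - deriv P z * h) * τ⁻¹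
        + (Q (z + h) - Q z - deriv Q z * h) * (s + k)⁻¹
        + Q z * k ^ 2 * (s + k)⁻¹ / s ^ 2 - deriv Q z * (h * k) * (s + k)⁻¹ / s := by
    have : ∀ x y : ℝ, x / τ + y = x * τ⁻¹ + y := fun x y => by rw [div_eq_mul_inv]
    rw [this, this, this]
    field_simp
    ring
  rw [key]
  have t1 : |(P (z + h) - P z - deriv P z * h) * τ⁻¹| ≤ 2 * M * (h ^ 2 / |τ|) := by
    rw [abs_mul, abs_inv]
    calc _ ≤ M * h ^ 2 * |τ|⁻¹ := by gcongr
      _ ≤ 2 * (M * h ^ 2 * |τ|⁻¹) := le_mul_of_one_le_left (by positivity) one_le_two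
      _ = _ := by ring
  have t2 : |(Q (z + h) - Q z - deriv Q z * h) * (s + k)⁻¹| ≤ 2 * M * (h ^ 2 / s) := by
    rw [abs_mul, abs_of_pos (inv_pos.2 hsk0)]
    calc _ ≤ M * h ^ 2 * (2 / s) := by gcongr
      _ = _ := by ring
  have t3 : |Q z * k ^ 2 * (s + k)⁻¹ / s ^ 2| ≤ 2 * M * (k ^ 2 / s ^ 3) := by
    rw [abs_div, abs_mul, abs_mul, abs_of_pos (inv_pos.2 hsk0), abs_of_nonneg (sq_nonneg k),
      abs_of_nonneg (sq_nonneg s)]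
    calc _ ≤ M * k ^ 2 * (2 / s) / s ^ 2 := by gcongr
      _ = _ := by field_simp
  have t4 : |deriv Q z * (h * k) * (s + k)⁻¹ / s| ≤ 2 * M * (|h| * |k| / s ^ 2) := by
    rw [abs_div, abs_mul, abs_mul, abs_mul h, abs_of_pos (inv_pos.2 hsk0), abs_of_pos hs]
    calc _ ≤ M * (|h| * |k|) * (2 / s) / s := by gcongr
      _ = _ := by field_simp
  refine (abs_sub _ _).trans ?_
  calc _ ≤ _ := add_le_add ((abs_add_le _ _).trans (add_le_add (abs_add_le _ _) le_rfl)) le_rfl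
    _ ≤ 2 * M * (h ^ 2 / |τ|) + 2 * M * (h ^ 2 / s) + 2 * M * (k ^ 2 / s ^ 3)
        + 2 * M * (|h| * |k| / s ^ 2) := by gcongr
    _ = _ := by ring

/-! ### Perturbations of an Euler equation -/

/-- Near infinity, `u = b t ^ (-μ) + O(t ^ (-1/2))`, and this may be differentiated twice. -/
structure ExpandsAtTop (μ b : ℝ) (u : ℝ → ℝ) : Prop where
  isBigO : (fun t => u t - b * t ^ (-μ)) =O[atTop] fun t : ℝ => t ^ (-(1 / 2) : ℝ)
  isBigO_deriv : (fun t => deriv u t + b * μ * t ^ (-μ - 1)) =O[atTop]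
    fun t : ℝ => t ^ (-(3 / 2) : ℝ)
  isBigO_deriv_deriv : (fun t => deriv (deriv u) t - b * μ * (μ + 1) * t ^ (-μ - 2)) =O[atTop]
    fun t : ℝ => t ^ (-(5 / 2) : ℝ)

theorem isBigO_inv_sq_rpow : (fun t : ℝ => (t ^ 2)⁻¹) =O[atTop] fun t : ℝ => t ^ (-2 : ℝ) := by
  refine (isBigO_rpow_mul isBigO_inv_rpow isBigO_inv_rpow (c := -2) (by norm_num)).congr_left ?_
  intro t
  rw [sq, mul_inv]

/-- The Euler operator `u'' + 2 u' / t + μ (1 - μ) u / t²` is `t⁻² (D + 1 - μ) (D + μ)`, with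
`D = t d/dt`, and both factors can be inverted by integrating against a power. -/
theorem exists_expandsAtTop {μ : ℝ} (hμ : μ < 1 / 2) {u : ℝ → ℝ} (hu : ContDiff ℝ 2 u)
    (hF : (fun t => deriv (deriv u) t + 2 / t * deriv u t + μ * (1 - μ) / t ^ 2 * u t) =O[atTop]
      fun t : ℝ => t ^ (-(5 / 2) : ℝ)) : ∃ b, ExpandsAtTop μ b u := by
  have hd : Differentiable ℝ u := hu.differentiable (by norm_num)
  have hd1 : Differentiable ℝ (deriv u) := (contDiff_one_deriv hu).differentiable (by norm_num)
  set F : ℝ → ℝ := fun t => deriv (deriv u) t + 2 / t * deriv u t + μ * (1 - μ) / t ^ 2 * u t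
    with hFdef
  set w : ℝ → ℝ := fun t => t * deriv u t + μ * u t with hw
  have hw' : ∀ t, HasDerivAt w (deriv u t + t * deriv (deriv u) t + μ * deriv u t) t := by
    intro t
    exact (((hasDerivAt_id' t).fun_mul (hd1 t).hasDerivAt).fun_add
      ((hd t).hasDerivAt.const_mul μ)).congr_deriv (by ring)
  have hW' : ∀ t : ℝ, 0 < t → HasDerivAt (fun t : ℝ => t ^ (1 - μ) * w t)
      (t ^ (2 - μ) * F t) t := by
    intro t ht
    refine ((Real.hasDerivAt_rpow_const (p := 1 - μ) (Or.inl ht.ne')).fun_mul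
      (hw' t)).congr_deriv ?_
    have e1 : t ^ (1 - μ - 1) = t ^ (-μ) := by congr 1; ring
    have e2 : t ^ (1 - μ) = t ^ (-μ) * t := by
      rw [← Real.rpow_add_one ht.ne']; congr 1; ring
    have e3 : t ^ (2 - μ) = t ^ (-μ) * t * t := by
      rw [← e2, ← Real.rpow_add_one ht.ne']; congr 1; ring
    rw [e1, e2, e3, hFdef, hw]
    field_simp
    ring
  have hW : (fun t : ℝ => t ^ (1 - μ) * w t) =O[atTop] fun t : ℝ => t ^ (1 / 2 - μ) := by
    refine isBigO_of_deriv_isBigO_of_pos hW' (by linarith) ?_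
    exact isBigO_rpow_mul (isBigO_refl _ _) hF (by ring)
  have hwO : w =O[atTop] fun t : ℝ => t ^ (-(1 / 2) : ℝ) := by
    refine (isBigO_rpow_mul (isBigO_refl (fun t : ℝ => t ^ (μ - 1)) _) hW
      (c := -(1 / 2)) (by ring)).congr' ?_ EventuallyEq.rfl
    filter_upwards [eventually_gt_atTop 0] with t ht
    rw [← mul_assoc, ← Real.rpow_add ht]
    simp
  have hV' : ∀ t : ℝ, 0 < t → HasDerivAt (fun t : ℝ => t ^ μ * u t) (t ^ (μ - 1) * w t) t := by
    intro t ht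
    refine ((Real.hasDerivAt_rpow_const (p := μ) (Or.inl ht.ne')).fun_mul
      (hd t).hasDerivAt).congr_deriv ?_
    rw [Real.rpow_sub_one ht.ne', hw]
    field_simp
    ring
  obtain ⟨b, hb⟩ := exists_sub_isBigO_of_deriv_isBigO_of_neg hV' (a := μ - 1 / 2) (by linarith)
    (isBigO_rpow_mul (isBigO_refl _ _) hwO (by ring))
  have h0 : (fun t => u t - b * t ^ (-μ)) =O[atTop] fun t : ℝ => t ^ (-(1 / 2) : ℝ) := by
    refine (isBigO_rpow_mul (isBigO_refl (fun t : ℝ => t ^ (-μ)) _) hb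
      (c := -(1 / 2)) (by ring)).congr' ?_ EventuallyEq.rfl
    filter_upwards [eventually_gt_atTop 0] with t ht
    rw [mul_sub, ← mul_assoc, ← Real.rpow_add ht]
    simp [mul_comm]
  have h1 : (fun t => deriv u t + b * μ * t ^ (-μ - 1)) =O[atTop]
      fun t : ℝ => t ^ (-(3 / 2) : ℝ) := by
    refine (isBigO_rpow_mul isBigO_inv_rpow (hwO.sub (h0.const_mul_left μ))
      (c := -(3 / 2)) (by norm_num)).congr' ?_ EventuallyEq.rfl
    filter_upwards [eventually_gt_atTop 0] with t ht
    rw [Real.rpow_sub_one ht.ne', hw]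
    field_simp
    ring
  refine ⟨b, h0, h1, ?_⟩
  refine ((hF.sub ((isBigO_rpow_mul isBigO_inv_rpow h1 (c := -(5 / 2))
    (by norm_num)).const_mul_left 2)).sub ((isBigO_rpow_mul isBigO_inv_sq_rpow h0 (c := -(5 / 2))
    (by norm_num)).const_mul_left (μ * (1 - μ)))).congr' ?_ EventuallyEq.rfl
  filter_upwards [eventually_gt_atTop 0] with t ht
  have e2 : t ^ (-μ - 2) = t ^ (-μ) / t ^ 2 := by
    rw [Real.rpow_sub ht]; norm_num
  rw [Real.rpow_sub_one ht.ne', e2]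
  simp only [hFdef]
  field_simp
  ring

theorem ExpandsAtTop.isBigO_rpow {μ b : ℝ} {u : ℝ → ℝ} (hμ : μ < 1 / 2) (h : ExpandsAtTop μ b u) :
    u =O[atTop] fun t : ℝ => t ^ (-μ) := by
  simpa using (isBigO_rpow_of_le h.isBigO (b := -μ) (by linarith)).add
    ((isBigO_refl (fun t : ℝ => t ^ (-μ)) atTop).const_mul_left b)

theorem ExpandsAtTop.deriv_isBigO_rpow {μ b : ℝ} {u : ℝ → ℝ} (hμ : μ < 1 / 2)
    (h : ExpandsAtTop μ b u) : deriv u =O[atTop] fun t : ℝ => t ^ (-μ - 1) := by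
  simpa using (isBigO_rpow_of_le h.isBigO_deriv (b := -μ - 1) (by linarith)).sub
    ((isBigO_refl (fun t : ℝ => t ^ (-μ - 1)) atTop).const_mul_left (b * μ))

theorem ExpandsAtTop.deriv_deriv_isBigO_rpow {μ b : ℝ} {u : ℝ → ℝ} (hμ : μ < 1 / 2)
    (h : ExpandsAtTop μ b u) : deriv (deriv u) =O[atTop] fun t : ℝ => t ^ (-μ - 2) := by
  simpa using (isBigO_rpow_of_le h.isBigO_deriv_deriv (b := -μ - 2) (by linarith)).add
    ((isBigO_refl (fun t : ℝ => t ^ (-μ - 2)) atTop).const_mul_left (b * μ * (μ + 1)))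

theorem rpow_isLittleO_rpow {m k : ℝ} (h : m < k) :
    (fun t : ℝ => t ^ m) =o[atTop] fun t : ℝ => t ^ k := by
  refine isLittleO_of_tendsto' ?_ ?_
  · filter_upwards [eventually_gt_atTop 0] with t ht h0
    exact absurd h0 (Real.rpow_pos_of_pos ht k).ne'
  · refine (tendsto_rpow_neg_atTop (y := k - m) (by linarith)).congr' ?_
    filter_upwards [eventually_gt_atTop 0] with t ht
    rw [neg_sub, Real.rpow_sub ht]

/-- A function with a leading power is comparable to it from below. -/
theorem rpow_isBigO_of_sub_isBigO {f : ℝ → ℝ} {b k m : ℝ} (hb : b ≠ 0) (hkm : m < k)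
    (h : (fun t => f t - b * t ^ k) =O[atTop] fun t : ℝ => t ^ m) :
    (fun t : ℝ => t ^ k) =O[atTop] f := by
  have h1 : (fun t : ℝ => f t - b * t ^ k) =o[atTop] fun t : ℝ => b * t ^ k :=
    (isLittleO_const_mul_right_iff hb).2 (h.trans_isLittleO (rpow_isLittleO_rpow hkm))
  have h2 : IsEquivalent atTop f (fun t : ℝ => b * t ^ k) := h1
  exact (isBigO_const_mul_left_iff hb).1 h2.isBigO_symm

/-! ### Locally uniformly convex functions -/

theorem LocallyUniformlyConvex.deriv_deriv_pos {f : ℝ → ℝ} (h : LocallyUniformlyConvex f)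
    (hf : ContDiff ℝ 2 f) (t : ℝ) : 0 < deriv (deriv f) t := by
  have hd : Differentiable ℝ f := hf.differentiable (by norm_num)
  have hd1 : Differentiable ℝ (deriv f) := (contDiff_one_deriv hf).differentiable (by norm_num)
  obtain ⟨m, hm, hconv⟩ := h (|t| + 1) (by positivity)
  rw [strongConvexOn_iff_convex] at hconv
  have h1 : ∀ x, HasDerivAt (fun x : ℝ => f x - m / 2 * ‖x‖ ^ 2) (deriv f x - m * x) x := by
    intro x
    simp only [Real.norm_eq_abs, sq_abs]
    exact ((hd x).hasDerivAt.fun_sub (((hasDerivAt_id' x).fun_pow 2).const_mul (m / 2))).congr_deriv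
      (by norm_num; ring)
  have hmono := hconv.monotoneOn_deriv fun x _ => (h1 x).differentiableAt
  rw [show deriv (fun x : ℝ => f x - m / 2 * ‖x‖ ^ 2) = fun x => deriv f x - m * x from
    funext fun x => (h1 x).deriv] at hmono
  have h2 : HasDerivAt (fun x => deriv f x - m * x) (deriv (deriv f) t - m * 1) t :=
    (hd1 t).hasDerivAt.fun_sub ((hasDerivAt_id' t).const_mul m)
  have h3 := hmono.derivWithin_nonneg (x := t)
  have hnhds : Icc (-(|t| + 1)) (|t| + 1) ∈ 𝓝 t :=
    Icc_mem_nhds (by linarith [neg_abs_le t]) (by linarith [le_abs_self t])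
  rw [derivWithin_of_mem_nhds hnhds, h2.deriv] at h3
  linarith

theorem locallyUniformlyConvex_of_deriv_deriv_pos {f : ℝ → ℝ} (hf : ContDiff ℝ 2 f)
    (h : ∀ t, 0 < deriv (deriv f) t) : LocallyUniformlyConvex f := by
  have hd : Differentiable ℝ f := hf.differentiable (by norm_num)
  have hf1 := contDiff_one_deriv hf
  have hd1 : Differentiable ℝ (deriv f) := hf1.differentiable (by norm_num)
  intro R hR
  obtain ⟨x₀, _, hmin⟩ := isCompact_Icc.exists_isMinOn (nonempty_Icc.2 (by linarith : -R ≤ R))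
    (hf1.continuous_deriv le_rfl).continuousOn
  set m := deriv (deriv f) x₀ with hm
  refine ⟨m, h x₀, ?_⟩
  rw [strongConvexOn_iff_convex]
  simp only [Real.norm_eq_abs, sq_abs]
  have h1 : ∀ x, HasDerivAt (fun x : ℝ => f x - m / 2 * x ^ 2) (deriv f x - m * x) x := fun x =>
    ((hd x).hasDerivAt.fun_sub (((hasDerivAt_id' x).fun_pow 2).const_mul (m / 2))).congr_deriv
      (by norm_num; ring)
  have h2 : ∀ x, HasDerivAt (fun x => deriv f x - m * x) (deriv (deriv f) x - m) x := fun x =>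
    ((hd1 x).hasDerivAt.fun_sub ((hasDerivAt_id' x).const_mul m)).congr_deriv (by ring)
  refine convexOn_of_hasDerivWithinAt2_nonneg (convex_Icc _ _)
    (fun x _ => (h1 x).continuousAt.continuousWithinAt) (fun x _ => (h1 x).hasDerivWithinAt)
    (fun x _ => (h2 x).hasDerivWithinAt) fun x hx => ?_
  have := hmin (interior_subset hx)
  simp only [mem_ofPred_eq] at this
  linarith

/-- The graph lies above its tangent lines. -/
theorem add_deriv_mul_sub_le {f : ℝ → ℝ} (hf : ContDiff ℝ 2 f) (h : ∀ t, 0 < deriv (deriv f) t)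
    (x y : ℝ) : f x + deriv f x * (y - x) ≤ f y := by
  have hd : Differentiable ℝ f := hf.differentiable (by norm_num)
  have hd1 : Differentiable ℝ (deriv f) := (contDiff_one_deriv hf).differentiable (by norm_num)
  have hmono : StrictMono (deriv f) := strictMono_of_deriv_pos h
  have hconv : ConvexOn ℝ univ f := hmono.monotone.convexOn_univ_of_deriv hd
  rcases lt_trichotomy x y with hxy | rfl | hxy
  · have := hconv.deriv_le_slope (mem_univ x) (mem_univ y) hxy (hd x)
    rw [slope_def_field, le_div_iff₀ (by linarith)] at this
    linarith
  · simp
  · have := hconv.slope_le_deriv (mem_univ y) (mem_univ x) hxy (hd x)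
    rw [slope_def_field, div_le_iff₀ (by linarith)] at this
    linarith

/-! ### The leaf profile -/

theorem opG_of_ne_zero (φ s : ℝ → ℝ) {τ : ℝ} (hτ : τ ≠ 0) :
    opG φ s τ = deriv (deriv s) τ + coeffP φ (deriv s τ) / τ + coeffQ φ (deriv s τ) / s τ := by
  simp [opG, divByVar, hτ]

namespace IsLeafProfile

variable {μ : ℝ} {φ σ : ℝ → ℝ}

theorem contDiff (hσ : IsLeafProfile μ φ σ) : ContDiff ℝ (⊤ : ℕ∞) σ := hσ.analytic.contDiff

theorem contDiff_two (hσ : IsLeafProfile μ φ σ) : ContDiff ℝ 2 σ := contDiff_infty.1 hσ.contDiff 2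

theorem contDiff_deriv (hσ : IsLeafProfile μ φ σ) : ContDiff ℝ (⊤ : ℕ∞) (deriv σ) :=
  (contDiff_infty_iff_deriv.1 hσ.contDiff).2

theorem contDiff_deriv_deriv (hσ : IsLeafProfile μ φ σ) :
    ContDiff ℝ (⊤ : ℕ∞) (deriv (deriv σ)) := (contDiff_infty_iff_deriv.1 hσ.contDiff_deriv).2

theorem differentiable (hσ : IsLeafProfile μ φ σ) : Differentiable ℝ σ :=
  hσ.contDiff.differentiable (by simp)

theorem differentiable_deriv (hσ : IsLeafProfile μ φ σ) : Differentiable ℝ (deriv σ) :=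
  hσ.contDiff_deriv.differentiable (by simp)

theorem deriv_deriv_pos (hσ : IsLeafProfile μ φ σ) (t : ℝ) : 0 < deriv (deriv σ) t :=
  hσ.convex.deriv_deriv_pos hσ.contDiff_two t

theorem deriv_zero (hσ : IsLeafProfile μ φ σ) : deriv σ 0 = 0 := deriv_zero_of_even hσ.even

theorem one_le (hσ : IsLeafProfile μ φ σ) (t : ℝ) : 1 ≤ σ t := by
  have := add_deriv_mul_sub_le hσ.contDiff_two hσ.deriv_deriv_pos 0 t
  rwa [hσ.deriv_zero, zero_mul, add_zero, hσ.at_zero] at this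

theorem pos (hσ : IsLeafProfile μ φ σ) (t : ℝ) : 0 < σ t := one_pos.trans_le (hσ.one_le t)

theorem isBigO_sub_self (hσ : IsLeafProfile μ φ σ) :
    (fun t => σ t - t) =O[atTop] fun t : ℝ => t ^ (-μ) := by
  obtain ⟨a, _, h⟩ := hσ.asymptotics
  refine (h.isBigO.add ((isBigO_refl (fun t : ℝ => t ^ (-μ)) atTop).const_mul_left a)).congr_left ?_
  intro t
  ring

theorem tendsto_sub_self (hμ : 0 < μ) (hσ : IsLeafProfile μ φ σ) :
    Tendsto (fun t => σ t - t) atTop (𝓝 0) :=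
  hσ.isBigO_sub_self.trans_tendsto (tendsto_rpow_neg_atTop hμ)

theorem deriv_lt_one (hμ : 0 < μ) (hσ : IsLeafProfile μ φ σ) (t : ℝ) : deriv σ t < 1 := by
  by_contra! hle
  -- `σ - τ` would be positive and nondecreasing after `t`
  have h1 : σ t - t ≤ 0 := by
    refine ge_of_tendsto (hσ.tendsto_sub_self hμ) ?_
    filter_upwards [eventually_ge_atTop t] with s hs
    have h2 := add_deriv_mul_sub_le hσ.contDiff_two hσ.deriv_deriv_pos t s
    nlinarith
  linarith [hσ.above_cone t, le_abs_self t]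

theorem abs_deriv_lt_one (hμ : 0 < μ) (hσ : IsLeafProfile μ φ σ) (t : ℝ) : |deriv σ t| < 1 := by
  rw [abs_lt]
  refine ⟨?_, hσ.deriv_lt_one hμ t⟩
  have := hσ.deriv_lt_one hμ (-t)
  rw [deriv_neg_of_even hσ.even] at this
  linarith

theorem f0_pos (hμ : 0 < μ) (hσ : IsLeafProfile μ φ σ) (t : ℝ) : 0 < f0 σ t := by
  have h1 : t * deriv σ t ≤ |t| := by
    refine (le_abs_self _).trans ?_
    rw [abs_mul]
    exact mul_le_of_le_one_right (abs_nonneg t) (hσ.abs_deriv_lt_one hμ t).le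
  rw [f0]
  linarith [hσ.above_cone t]

/-- The tangent at `t`, compared with the graph at `t / 2`, bounds the slope of the positive convex
function `σ - t` by its values. -/
theorem isBigO_deriv_sub_one (hμ : 0 < μ) (hσ : IsLeafProfile μ φ σ) :
    (fun t => deriv σ t - 1) =O[atTop] fun t : ℝ => t ^ (-μ - 1) := by
  have h2 : Tendsto (fun t : ℝ => t / 2) atTop atTop := tendsto_id.atTop_div_const two_pos
  have h3 : (fun t => σ (t / 2) - t / 2) =O[atTop] fun t : ℝ => t ^ (-μ) := by
    have h4 := hσ.isBigO_sub_self.comp_tendsto h2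
    refine h4.trans (IsBigO.of_bound ((1 / 2) ^ (-μ)) ?_)
    filter_upwards [eventually_gt_atTop 0] with t ht
    simp only [Function.comp]
    rw [div_eq_inv_mul, Real.mul_rpow (by norm_num) ht.le, norm_mul,
      Real.norm_of_nonneg (by positivity)]
    norm_num
  refine IsBigO.trans (g := fun t : ℝ => t⁻¹ * (σ (t / 2) - t / 2)) ?_
    (isBigO_rpow_mul isBigO_inv_rpow h3 (by ring))
  refine IsBigO.of_bound 2 ?_
  filter_upwards [eventually_gt_atTop 0] with t ht
  have h4 := add_deriv_mul_sub_le hσ.contDiff_two hσ.deriv_deriv_pos t (t / 2)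
  have h5 := hσ.above_cone t
  have h6 := hσ.above_cone (t / 2)
  rw [abs_of_pos ht] at h5
  rw [abs_of_pos (by positivity)] at h6
  rw [norm_mul, Real.norm_of_nonneg (by positivity : 0 ≤ t⁻¹),
    Real.norm_of_nonneg (by linarith : 0 ≤ σ (t / 2) - t / 2), Real.norm_eq_abs,
    abs_of_neg (by linarith [hσ.deriv_lt_one hμ t])]
  rw [inv_mul_eq_div, ← mul_div_assoc, le_div_iff₀ ht]
  nlinarith

theorem deriv_sub_self (hσ : IsLeafProfile μ φ σ) :
    deriv (fun t => σ t - t) = fun t => deriv σ t - 1 :=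
  funext fun t => ((hσ.differentiable t).hasDerivAt.fun_sub (hasDerivAt_id' t)).deriv

/-- The expansion of the profile. The difference `σ - τ` solves the Euler equation of the cone up to
a quadratic error, by the equation of the profile and the first order expansion at slope one. -/
theorem exists_expandsAtTop (hφ : IsGenerator φ) (hσ : IsLeafProfile μ φ σ) (hμ : 0 < μ)
    (hμ' : μ < 1 / 2) (hP : coeffP φ 1 = μ * (1 - μ)) :
    ∃ a, 0 < a ∧ ExpandsAtTop μ a (fun t => σ t - t) := by
  have hv : ContDiff ℝ 2 (fun t => σ t - t) := hσ.contDiff_two.sub contDiff_id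
  have hd2 : deriv (deriv fun t => σ t - t) = deriv (deriv σ) := by
    rw [hσ.deriv_sub_self]
    ext t
    simp
  have hv0 := hσ.isBigO_sub_self
  have hv1 := hσ.isBigO_deriv_sub_one hμ
  have hmain : (fun t => deriv (deriv fun t => σ t - t) t + 2 / t * deriv (fun t => σ t - t) t
      + μ * (1 - μ) / t ^ 2 * (σ t - t)) =O[atTop] fun t : ℝ => t ^ (-(5 / 2) : ℝ) := by
    obtain ⟨C, hC, hrem⟩ := exists_abs_remainder_le (contDiff_infty.1 hφ.contDiff_coeffP 2)
      (contDiff_infty.1 hφ.contDiff_coeffQ 2)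
    have hinv3 := isBigO_rpow_mul isBigO_inv_sq_rpow isBigO_inv_rpow (c := -3) (by norm_num)
    have b1 := isBigO_rpow_mul (isBigO_rpow_mul hv1 hv1 rfl) isBigO_inv_rpow
      (c := -2 * μ - 3) (by ring)
    have b2 := isBigO_rpow_mul (isBigO_rpow_mul hv1.norm_left hv0.norm_left rfl)
      isBigO_inv_sq_rpow (c := -2 * μ - 3) (by ring)
    have b3 := isBigO_rpow_mul (isBigO_rpow_mul hv0 hv0 rfl) hinv3 (c := -2 * μ - 3) (by ring)
    have hb := (((b1.add b1).add b2).add b3).const_mul_left C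
    refine IsBigO.trans (IsBigO.of_bound 1 ?_) (isBigO_rpow_of_le hb (by linarith))
    have hsmall := (hσ.tendsto_sub_self hμ).eventually (gt_mem_nhds one_half_pos)
    filter_upwards [eventually_ge_atTop 1, hsmall] with t ht hvt
    have ht0 : 0 < t := by linarith
    have hcone := hσ.above_cone t
    rw [abs_of_pos ht0] at hcone
    have hslope := abs_lt.1 (hσ.abs_deriv_lt_one hμ t)
    have h := hrem 1 (deriv σ t - 1) t (σ t - t) t (by norm_num)
      ⟨by linarith, by linarith⟩ ht0 (by rw [abs_of_pos (by linarith)]; linarith)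
    have heq := hσ.equation t
    rw [opG_of_ne_zero _ _ ht0.ne'] at heq
    rw [add_sub_cancel, add_sub_cancel, hφ.coeffQ_one, hP, abs_of_pos ht0] at h
    rw [hd2, hσ.deriv_sub_self, one_mul, Real.norm_eq_abs]
    have hsum := hφ.deriv_coeffP_add_deriv_coeffQ_one
    have e1 : coeffP φ (deriv σ t) / t + coeffQ φ (deriv σ t) / σ t
        - (μ * (1 - μ) / t + -(μ * (1 - μ)) / t) - (deriv (coeffP φ) 1 * (deriv σ t - 1) / t
        + deriv (coeffQ φ) 1 * (deriv σ t - 1) / t - -(μ * (1 - μ)) * (σ t - t) / t ^ 2)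
        = -(deriv (deriv σ) t + 2 / t * (deriv σ t - 1)
          + μ * (1 - μ) / t ^ 2 * (σ t - t)) := by
      have e2 : deriv (coeffQ φ) 1 = 2 - deriv (coeffP φ) 1 := by linarith
      have e3 : coeffP φ (deriv σ t) / t + coeffQ φ (deriv σ t) / σ t = -deriv (deriv σ) t := by
        linarith
      rw [e2, e3]
      field_simp
      ring
    rw [e1, abs_neg] at h
    refine h.trans (le_of_eq ?_)
    rw [Real.norm_of_nonneg]
    · simp only [Real.norm_eq_abs]
      field_simp
    · simp only [← sq]
      positivity
  obtain ⟨b, hb⟩ := _root_.exists_expandsAtTop hμ' hv hmain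
  obtain ⟨a, ha, hlim⟩ := hσ.asymptotics
  have hab : a = b := by
    by_contra hne
    have h1 := (hb.isBigO.trans_isLittleO (rpow_isLittleO_rpow (k := -μ) (by linarith))).sub hlim
    have h2 : (fun t : ℝ => (a - b) * t ^ (-μ)) =o[atTop] fun t : ℝ => t ^ (-μ) :=
      h1.congr_left fun t => by ring
    rw [isLittleO_const_mul_left_iff (sub_ne_zero.2 hne)] at h2
    refine isLittleO_irrefl (Eventually.frequently ?_) h2
    filter_upwards [eventually_gt_atTop 0] with t ht using (Real.rpow_pos_of_pos ht _).ne'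
  exact ⟨a, ha, hab ▸ hb⟩

theorem isTheta_rpow (hμ : 0 < μ) (hσ : IsLeafProfile μ φ σ) (e : ℝ) :
    (fun t => σ t ^ e) =Θ[atTop] fun t : ℝ => t ^ e := by
  have h1 : IsEquivalent atTop σ (fun t : ℝ => t) := by
    have : (fun t => σ t - t) =o[atTop] fun t : ℝ => t := by
      refine hσ.isBigO_sub_self.trans_isLittleO ?_
      simpa using rpow_isLittleO_rpow (m := -μ) (k := 1) (by linarith)
    exact this
  exact h1.isTheta.rpow (Eventually.of_forall fun t => (hσ.pos t).le) (eventually_ge_atTop 0)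

end IsLeafProfile

/-! ### Continuity at the axis -/

theorem continuous_divByVar {h : ℝ → ℝ} (hh : Differentiable ℝ h) (h0 : h 0 = 0) :
    Continuous (divByVar h) := by
  have h1 : divByVar h = dslope h 0 := by
    ext τ
    rcases eq_or_ne τ 0 with rfl | hτ
    · simp [divByVar]
    · rw [dslope_of_ne _ hτ, slope_def_field, divByVar, if_neg hτ, h0, sub_zero, sub_zero]
  rw [h1, ← continuousOn_univ, continuousOn_dslope univ_mem]
  exact ⟨hh.continuous.continuousOn, hh 0⟩

theorem continuous_opG {φ s : ℝ → ℝ} (hφ : IsGenerator φ) (hs : ContDiff ℝ 2 s)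
    (hs0 : ∀ τ, s τ ≠ 0) (heven : ∀ τ, s (-τ) = s τ) : Continuous (opG φ s) := by
  have hs1 := contDiff_one_deriv hs
  have hP : Differentiable ℝ (coeffP φ) := hφ.contDiff_coeffP.differentiable (by simp)
  refine ((hs1.continuous_deriv le_rfl).add (continuous_divByVar
    (hP.comp (hs1.differentiable (by norm_num))) ?_)).add
    ((hφ.contDiff_coeffQ.continuous.comp hs1.continuous).div hs.continuous hs0)
  simp [deriv_zero_of_even heven, hφ.coeffP_zero]

/-- Away from the axis, the operator `opL` is the linearization of `opG`. -/
theorem opL_of_ne_zero {μ : ℝ} {φ σ : ℝ → ℝ} (hφ : IsGenerator φ) (hσ : IsLeafProfile μ φ σ)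
    (f : ℝ → ℝ) {τ : ℝ} (hτ : τ ≠ 0) :
    opL φ σ f τ = deriv (deriv f) τ
      + (deriv (coeffP φ) (deriv σ τ) / τ + deriv (coeffQ φ) (deriv σ τ) / σ τ) * deriv f τ
      - coeffQ φ (deriv σ τ) / σ τ ^ 2 * f τ := by
  have h0 := (hφ.deriv_deriv_pos (deriv σ τ)).ne'
  have h1 := (hσ.pos τ).ne'
  have heq := hσ.equation τ
  rw [opG_of_ne_zero _ _ hτ] at heq
  have h2 : deriv (deriv σ) τ = -(coeffP φ (deriv σ τ) / τ + coeffQ φ (deriv σ τ) / σ τ) := by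
    linarith
  rw [hφ.deriv_coeffP, hφ.deriv_coeffQ, opL, divByVar, if_neg hτ, h2, coeffP, coeffQ]
  field_simp
  ring

namespace IsLeafProfile

variable {μ : ℝ} {φ σ : ℝ → ℝ}

theorem continuous_opL (hφ : IsGenerator φ) (hσ : IsLeafProfile μ φ σ) {f : ℝ → ℝ}
    (hf : ContDiff ℝ 2 f) (heven : ∀ τ, f (-τ) = f τ) : Continuous (opL φ σ f) := by
  have hf1 := contDiff_one_deriv hf
  have c1 := hφ.contDiff.continuous
  have c2 := hφ.contDiff_deriv.continuous
  have c3 := hφ.contDiff_deriv_deriv.continuous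
  have c4 := (contDiff_infty_iff_deriv.1 hφ.contDiff_deriv_deriv).2.continuous
  have s0 := hσ.contDiff.continuous
  have s1 := hσ.contDiff_deriv.continuous
  have s2 := hσ.contDiff_deriv_deriv.continuous
  have n1 : ∀ τ, σ τ ≠ 0 := fun τ => (hσ.pos τ).ne'
  have n2 : ∀ τ, deriv (deriv φ) (deriv σ τ) ≠ 0 := fun τ => (hφ.deriv_deriv_pos _).ne'
  refine (((hf1.continuous_deriv le_rfl).add (continuous_divByVar
    (hf1.differentiable (by norm_num)) (deriv_zero_of_even heven))).add (Continuous.mul ?_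
    hf1.continuous)).add (Continuous.mul ?_ hf.continuous)
  · exact (s1.div s0 n1).add ((s2.mul (c4.comp s1)).div (c3.comp s1) n2)
  · exact ((c1.comp s1).sub (s1.mul (c2.comp s1))).div ((s0.pow 2).mul (c3.comp s1))
      fun τ => mul_ne_zero (pow_ne_zero 2 (n1 τ)) (n2 τ)

/-! ### Regularity of the solution of the linearized equation -/

theorem contDiff_f0 (hσ : IsLeafProfile μ φ σ) : ContDiff ℝ (⊤ : ℕ∞) (f0 σ) :=
  hσ.contDiff.sub (contDiff_id.mul hσ.contDiff_deriv)

theorem hasDerivAt_f0 (hσ : IsLeafProfile μ φ σ) (τ : ℝ) :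
    HasDerivAt (f0 σ) (-(τ * deriv (deriv σ) τ)) τ :=
  ((hσ.differentiable τ).hasDerivAt.fun_sub ((hasDerivAt_id' τ).fun_mul
    (hσ.differentiable_deriv τ).hasDerivAt)).congr_deriv (by ring)

theorem f0_neg (hσ : IsLeafProfile μ φ σ) (τ : ℝ) : f0 σ (-τ) = f0 σ τ := by
  rw [f0, f0, hσ.even, deriv_neg_of_even hσ.even]
  ring

end IsLeafProfile

/-- The weight `p` divided by `τ`. -/
noncomputable def reducedWeight (φ σ : ℝ → ℝ) (τ : ℝ) : ℝ := σ τ * deriv (deriv φ) (deriv σ τ)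

/-- The integrand of the inner integral of `f1`, divided by its variable. -/
noncomputable def reducedSource (φ σ : ℝ → ℝ) (τ : ℝ) : ℝ :=
  σ τ ^ (-(5 / 2) : ℝ) * reducedWeight φ σ τ * f0 σ τ

/-- The inner integral of `f1`, divided by the square of its upper limit. -/
noncomputable def reducedPrimitive (φ σ : ℝ → ℝ) (τ : ℝ) : ℝ :=
  ∫ u in (0 : ℝ)..1, u ^ 1 * reducedSource φ σ (τ * u)

/-- The integrand of the outer integral of `f1`, divided by its variable. -/
noncomputable def reducedSlope (φ σ : ℝ → ℝ) (τ : ℝ) : ℝ :=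
  reducedPrimitive φ σ τ / (f0 σ τ ^ 2 * reducedWeight φ σ τ)

/-- The quotient `f₁ / f₀`. -/
noncomputable def quotientF1 (φ σ : ℝ → ℝ) (τ : ℝ) : ℝ :=
  ∫ t in (0 : ℝ)..τ, t * reducedSlope φ σ t

theorem integral_weightP (φ σ : ℝ → ℝ) (t : ℝ) :
    ∫ s in (0 : ℝ)..t, σ s ^ (-(5 / 2) : ℝ) * weightP φ σ s * f0 σ s =
      t ^ 2 * reducedPrimitive φ σ t := by
  rw [reducedPrimitive, ← integral_mul_eq_sq_mul_integral]
  congr 1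
  ext s
  rw [reducedSource, reducedWeight, weightP]
  ring

theorem f1_eq (φ σ : ℝ → ℝ) (τ : ℝ) : f1 φ σ τ = f0 σ τ * quotientF1 φ σ τ := by
  rw [f1, quotientF1]
  congr 2
  ext t
  rw [integral_weightP, reducedSlope, weightP, reducedWeight]
  rcases eq_or_ne t 0 with rfl | ht
  · simp
  · field_simp

namespace IsLeafProfile

variable {μ : ℝ} {φ σ : ℝ → ℝ}

theorem reducedWeight_pos (hφ : IsGenerator φ) (hσ : IsLeafProfile μ φ σ) (τ : ℝ) :
    0 < reducedWeight φ σ τ := mul_pos (hσ.pos τ) (hφ.deriv_deriv_pos _)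

theorem contDiff_reducedWeight (hφ : IsGenerator φ) (hσ : IsLeafProfile μ φ σ) :
    ContDiff ℝ (⊤ : ℕ∞) (reducedWeight φ σ) :=
  hσ.contDiff.mul (hφ.contDiff_deriv_deriv.comp hσ.contDiff_deriv)

theorem hasDerivAt_reducedWeight (hφ : IsGenerator φ) (hσ : IsLeafProfile μ φ σ) (τ : ℝ) :
    HasDerivAt (reducedWeight φ σ) (deriv σ τ * deriv (deriv φ) (deriv σ τ)
      + σ τ * (deriv (deriv (deriv φ)) (deriv σ τ) * deriv (deriv σ) τ)) τ :=
  (hσ.differentiable τ).hasDerivAt.fun_mul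
    ((hφ.contDiff_deriv_deriv.differentiable (by simp) _).hasDerivAt.comp τ
      (hσ.differentiable_deriv τ).hasDerivAt)

theorem contDiff_reducedSource (hφ : IsGenerator φ) (hσ : IsLeafProfile μ φ σ) :
    ContDiff ℝ (⊤ : ℕ∞) (reducedSource φ σ) :=
  ((hσ.contDiff.rpow_const_of_ne fun τ => (hσ.pos τ).ne').mul
    (hσ.contDiff_reducedWeight hφ)).mul hσ.contDiff_f0

theorem reducedSource_pos (hφ : IsGenerator φ) (hσ : IsLeafProfile μ φ σ) (hμ : 0 < μ) (τ : ℝ) :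
    0 < reducedSource φ σ τ :=
  mul_pos (mul_pos (Real.rpow_pos_of_pos (hσ.pos τ) _) (hσ.reducedWeight_pos hφ τ))
    (hσ.f0_pos hμ τ)

theorem contDiff_reducedPrimitive (hφ : IsGenerator φ) (hσ : IsLeafProfile μ φ σ) :
    ContDiff ℝ (⊤ : ℕ∞) (reducedPrimitive φ σ) :=
  contDiff_integral_pow_mul_comp_mul (hσ.contDiff_reducedSource hφ) 1

theorem hasDerivAt_sq_mul_reducedPrimitive (hφ : IsGenerator φ) (hσ : IsLeafProfile μ φ σ)
    (τ : ℝ) : HasDerivAt (fun t => t ^ 2 * reducedPrimitive φ σ t) (τ * reducedSource φ σ τ) τ := by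
  have hc : Continuous fun s => s * reducedSource φ σ s :=
    continuous_id.mul (hσ.contDiff_reducedSource hφ).continuous
  refine (hc.integral_hasStrictDerivAt 0 τ).hasDerivAt.congr_of_eventuallyEq
    (Eventually.of_forall fun t => ?_)
  exact (integral_mul_eq_sq_mul_integral t).symm

theorem reducedPrimitive_nonneg (hφ : IsGenerator φ) (hσ : IsLeafProfile μ φ σ) (hμ : 0 < μ)
    (τ : ℝ) : 0 ≤ reducedPrimitive φ σ τ :=
  intervalIntegral.integral_nonneg zero_le_one fun _ hu =>
    mul_nonneg (pow_nonneg hu.1 1) (hσ.reducedSource_pos hφ hμ _).le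

theorem contDiff_reducedSlope (hφ : IsGenerator φ) (hσ : IsLeafProfile μ φ σ) (hμ : 0 < μ) :
    ContDiff ℝ (⊤ : ℕ∞) (reducedSlope φ σ) :=
  (hσ.contDiff_reducedPrimitive hφ).div ((hσ.contDiff_f0.pow 2).mul (hσ.contDiff_reducedWeight hφ))
    fun τ => (mul_pos (pow_pos (hσ.f0_pos hμ τ) 2) (hσ.reducedWeight_pos hφ τ)).ne'

theorem reducedSlope_nonneg (hφ : IsGenerator φ) (hσ : IsLeafProfile μ φ σ) (hμ : 0 < μ)
    (τ : ℝ) : 0 ≤ reducedSlope φ σ τ :=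
  div_nonneg (hσ.reducedPrimitive_nonneg hφ hμ τ)
    (mul_pos (pow_pos (hσ.f0_pos hμ τ) 2) (hσ.reducedWeight_pos hφ τ)).le

theorem reducedSlope_neg (hσ : IsLeafProfile μ φ σ) (hφ : IsGenerator φ) (τ : ℝ) :
    reducedSlope φ σ (-τ) = reducedSlope φ σ τ := by
  have h1 : ∀ t, reducedWeight φ σ (-t) = reducedWeight φ σ t := fun t => by
    rw [reducedWeight, reducedWeight, hσ.even, deriv_neg_of_even hσ.even,
      deriv_neg_of_odd (deriv_neg_of_even hφ.even)]
  have h2 : ∀ t, reducedSource φ σ (-t) = reducedSource φ σ t := fun t => by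
    rw [reducedSource, reducedSource, hσ.even, hσ.f0_neg, h1]
  rw [reducedSlope, reducedSlope, hσ.f0_neg, h1, reducedPrimitive, reducedPrimitive]
  simp only [neg_mul, h2]

theorem hasDerivAt_quotientF1 (hφ : IsGenerator φ) (hσ : IsLeafProfile μ φ σ) (hμ : 0 < μ)
    (τ : ℝ) : HasDerivAt (quotientF1 φ σ) (τ * reducedSlope φ σ τ) τ :=
  ((continuous_id.mul (hσ.contDiff_reducedSlope hφ hμ).continuous).integral_hasStrictDerivAt
    0 τ).hasDerivAt

theorem contDiff_quotientF1 (hφ : IsGenerator φ) (hσ : IsLeafProfile μ φ σ) (hμ : 0 < μ) :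
    ContDiff ℝ (⊤ : ℕ∞) (quotientF1 φ σ) := by
  have h := hσ.hasDerivAt_quotientF1 hφ hμ
  refine contDiff_infty_iff_deriv.2 ⟨fun τ => (h τ).differentiableAt, ?_⟩
  rw [show deriv (quotientF1 φ σ) = fun τ => τ * reducedSlope φ σ τ from
    funext fun τ => (h τ).deriv]
  exact contDiff_id.mul (hσ.contDiff_reducedSlope hφ hμ)

theorem quotientF1_neg (hφ : IsGenerator φ) (hσ : IsLeafProfile μ φ σ) (τ : ℝ) :
    quotientF1 φ σ (-τ) = quotientF1 φ σ τ := by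
  have h := intervalIntegral.integral_comp_neg (a := 0) (b := τ) fun t => t * reducedSlope φ σ t
  simp only [hσ.reducedSlope_neg hφ, neg_mul, intervalIntegral.integral_neg, neg_zero] at h
  rw [quotientF1, quotientF1, intervalIntegral.integral_symm, ← h, neg_neg]

theorem quotientF1_nonneg (hφ : IsGenerator φ) (hσ : IsLeafProfile μ φ σ) (hμ : 0 < μ) (τ : ℝ) :
    0 ≤ quotientF1 φ σ τ := by
  have key : ∀ t, 0 ≤ t → 0 ≤ quotientF1 φ σ t := fun t ht =>
    intervalIntegral.integral_nonneg ht fun _ hu => mul_nonneg hu.1 (hσ.reducedSlope_nonneg hφ hμ _)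
  rcases le_total 0 τ with h | h
  · exact key τ h
  · rw [← hσ.quotientF1_neg hφ]
    exact key _ (by linarith)

theorem contDiff_f1 (hφ : IsGenerator φ) (hσ : IsLeafProfile μ φ σ) (hμ : 0 < μ) :
    ContDiff ℝ (⊤ : ℕ∞) (f1 φ σ) := by
  rw [show f1 φ σ = fun τ => f0 σ τ * quotientF1 φ σ τ from funext (f1_eq φ σ)]
  exact hσ.contDiff_f0.mul (hσ.contDiff_quotientF1 hφ hμ)

theorem f1_neg (hφ : IsGenerator φ) (hσ : IsLeafProfile μ φ σ) (τ : ℝ) :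
    f1 φ σ (-τ) = f1 φ σ τ := by
  rw [f1_eq, f1_eq, hσ.f0_neg, hσ.quotientF1_neg hφ]

theorem f1_nonneg (hφ : IsGenerator φ) (hσ : IsLeafProfile μ φ σ) (hμ : 0 < μ) (τ : ℝ) :
    0 ≤ f1 φ σ τ := by
  rw [f1_eq]
  exact mul_nonneg (hσ.f0_pos hμ τ).le (hσ.quotientF1_nonneg hφ hμ τ)

theorem hasDerivAt_f1 (hφ : IsGenerator φ) (hσ : IsLeafProfile μ φ σ) (hμ : 0 < μ) (τ : ℝ) :
    HasDerivAt (f1 φ σ) (-(τ * deriv (deriv σ) τ) * quotientF1 φ σ τ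
      + f0 σ τ * (τ * reducedSlope φ σ τ)) τ := by
  rw [show f1 φ σ = fun τ => f0 σ τ * quotientF1 φ σ τ from funext (f1_eq φ σ)]
  exact (hσ.hasDerivAt_f0 τ).fun_mul (hσ.hasDerivAt_quotientF1 hφ hμ τ)

/-! ### The linearized equation -/

/-- The dilations of a solution are solutions, and `f₀` is minus their derivative in the dilation
parameter. -/
theorem opL_f0 (hφ : IsGenerator φ) (hσ : IsLeafProfile μ φ σ) {τ : ℝ} (hτ : τ ≠ 0) :
    opL φ σ (f0 σ) τ = 0 := by
  have d1 : deriv (f0 σ) = fun t => -(t * deriv (deriv σ) t) :=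
    funext fun t => (hσ.hasDerivAt_f0 t).deriv
  have hσ3 := (hσ.contDiff_deriv_deriv.differentiable (by simp) τ).hasDerivAt
  have d2 : deriv (deriv (f0 σ)) τ
      = -(deriv (deriv σ) τ + τ * deriv (deriv (deriv σ)) τ) := by
    rw [d1]
    refine (((hasDerivAt_id' τ).fun_mul hσ3).fun_neg.congr_deriv ?_).deriv
    ring
  have hP := (hφ.contDiff_coeffP.differentiable (by simp) (deriv σ τ)).hasDerivAt
  have hQ := (hφ.contDiff_coeffQ.differentiable (by simp) (deriv σ τ)).hasDerivAt
  have hσ1 := (hσ.differentiable τ).hasDerivAt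
  have hσ2 := (hσ.differentiable_deriv τ).hasDerivAt
  have hG : HasDerivAt (fun t => deriv (deriv σ) t + coeffP φ (deriv σ t) / t
      + coeffQ φ (deriv σ t) / σ t) _ τ :=
    (hσ3.fun_add ((hP.comp τ hσ2).fun_div (hasDerivAt_id' τ) hτ)).fun_add
      ((hQ.comp τ hσ2).fun_div hσ1 (hσ.pos τ).ne')
  have hG0 : (fun t => deriv (deriv σ) t + coeffP φ (deriv σ t) / t
      + coeffQ φ (deriv σ t) / σ t) =ᶠ[𝓝 τ] fun _ => 0 := by
    filter_upwards [isOpen_ne.mem_nhds hτ] with t ht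
    rw [← opG_of_ne_zero φ σ ht, hσ.equation]
  have e1 := hG.unique ((hasDerivAt_const τ (0 : ℝ)).congr_of_eventuallyEq hG0)
  have e0 := hG0.self_of_nhds
  have hσ0 := (hσ.pos τ).ne'
  simp only [Function.comp_def] at e1 e0
  rw [opL_of_ne_zero hφ hσ _ hτ, d2, (hσ.hasDerivAt_f0 τ).deriv, f0]
  linear_combination (norm := (field_simp; ring)) (-τ) * e1 - e0

/-- Reduction of order: `p f₀² (f₁ / f₀)'` is the inner integral. -/
theorem opL_f1 (hφ : IsGenerator φ) (hσ : IsLeafProfile μ φ σ) (hμ : 0 < μ) (τ : ℝ) :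
    opL φ σ (f1 φ σ) τ = σ τ ^ (-(5 / 2) : ℝ) := by
  have hcont : Continuous fun τ => σ τ ^ (-(5 / 2) : ℝ) :=
    hσ.contDiff.continuous.rpow_const fun τ => Or.inl (hσ.pos τ).ne'
  refine congrFun (Continuous.ext_on (dense_compl_singleton (0 : ℝ)) (hσ.continuous_opL hφ
    (contDiff_infty.1 (hσ.contDiff_f1 hφ hμ) 2) (hσ.f1_neg hφ)) hcont fun τ hτ => ?_) τ
  replace hτ : τ ≠ 0 := hτ
  have h0 := hσ.opL_f0 hφ hτ
  have d1 : deriv (f1 φ σ) = fun t => -(t * deriv (deriv σ) t) * quotientF1 φ σ t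
      + f0 σ t * (t * reducedSlope φ σ t) := funext fun t => (hσ.hasDerivAt_f1 hφ hμ t).deriv
  have d0 : deriv (f0 σ) = fun t => -(t * deriv (deriv σ) t) :=
    funext fun t => (hσ.hasDerivAt_f0 t).deriv
  have hf0' : HasDerivAt (fun t => -(t * deriv (deriv σ) t)) (deriv (deriv (f0 σ)) τ) τ := by
    rw [← d0]
    exact ((contDiff_infty_iff_deriv.1 hσ.contDiff_f0).2.differentiable (by simp) τ).hasDerivAt
  have hK : HasDerivAt (fun t => t * reducedSlope φ σ t)
      (deriv (fun t => t * reducedSlope φ σ t) τ) τ :=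
    ((contDiff_id.mul (hσ.contDiff_reducedSlope hφ hμ)).differentiable (by simp) τ).hasDerivAt
  have d2 : deriv (deriv (f1 φ σ)) τ = deriv (deriv (f0 σ)) τ * quotientF1 φ σ τ
      + 2 * (-(τ * deriv (deriv σ) τ) * (τ * reducedSlope φ σ τ))
      + f0 σ τ * deriv (fun t => t * reducedSlope φ σ t) τ := by
    rw [d1]
    refine (((hf0'.fun_mul (hσ.hasDerivAt_quotientF1 hφ hμ τ)).fun_add
      ((hσ.hasDerivAt_f0 τ).fun_mul hK)).congr_deriv ?_).deriv
    ring
  have hsq : HasDerivAt (fun t => f0 σ t ^ 2) (2 * f0 σ τ * -(τ * deriv (deriv σ) τ)) τ :=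
    ((hσ.hasDerivAt_f0 τ).fun_pow 2).congr_deriv (by norm_num)
  have hA := ((((hasDerivAt_id' τ).fun_mul (hσ.hasDerivAt_reducedWeight hφ τ)).fun_mul
    hsq).fun_mul hK)
  have hprod : (fun t => t * reducedWeight φ σ t * f0 σ t ^ 2 * (t * reducedSlope φ σ t))
      = fun t => t ^ 2 * reducedPrimitive φ σ t := by
    ext t
    have w1 := (hσ.reducedWeight_pos hφ t).ne'
    have w2 := (hσ.f0_pos hμ t).ne'
    rw [reducedSlope]
    field_simp
  rw [hprod] at hA
  have e1 := hA.unique (hσ.hasDerivAt_sq_mul_reducedPrimitive hφ τ)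
  rw [opL, divByVar, if_neg hτ] at h0 ⊢
  have w1 := (hσ.pos τ).ne'
  have w2 := (hσ.f0_pos hμ τ).ne'
  have w3 := (hφ.deriv_deriv_pos (deriv σ τ)).ne'
  rw [d2, d1, f1_eq]
  rw [d0] at h0
  rw [reducedSource, reducedWeight] at e1
  rw [d0]
  beta_reduce at h0 ⊢
  generalize deriv (fun t => -(t * deriv (deriv σ) t)) τ = y2 at *
  generalize deriv (fun t => t * reducedSlope φ σ t) τ = K' at *
  generalize quotientF1 φ σ τ = J at *
  generalize reducedSlope φ σ τ = K at *
  generalize σ τ ^ (-(5 / 2) : ℝ) = S at *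
  generalize f0 σ τ = y at *
  linear_combination (norm := (field_simp; ring)) J * h0
    + (τ * (σ τ * deriv (deriv φ) (deriv σ τ)) * y)⁻¹ * e1

end IsLeafProfile

/-! ### Behaviour at infinity of the solution of the linearized equation -/

namespace IsLeafProfile

variable {μ : ℝ} {φ σ : ℝ → ℝ}

theorem isBigO_inv (hσ : IsLeafProfile μ φ σ) (hμ : 0 < μ) :
    (fun t => (σ t)⁻¹) =O[atTop] fun t : ℝ => t ^ (-1 : ℝ) := by
  simpa only [Real.rpow_neg_one] using (hσ.isTheta_rpow hμ (-1)).1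

theorem tendsto_deriv (hσ : IsLeafProfile μ φ σ) (hμ : 0 < μ) :
    Tendsto (deriv σ) atTop (𝓝 1) := by
  have h : Tendsto (fun t => deriv σ t - 1) atTop (𝓝 0) :=
    (hσ.isBigO_deriv_sub_one hμ).trans_tendsto (by
      rw [← neg_add']
      exact tendsto_rpow_neg_atTop (by linarith))
  simpa using h.add_const 1

theorem isBigO_comp_deriv (hσ : IsLeafProfile μ φ σ) (hμ : 0 < μ) {f : ℝ → ℝ}
    (hf : ContinuousAt f 1) : (fun t => f (deriv σ t)) =O[atTop] fun t : ℝ => t ^ (0 : ℝ) := by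
  simpa using (hf.tendsto.comp (hσ.tendsto_deriv hμ)).isBigO_one ℝ

theorem isBigO_comp_deriv_sub (hσ : IsLeafProfile μ φ σ) (hμ : 0 < μ) {f : ℝ → ℝ}
    (hf : DifferentiableAt ℝ f 1) :
    (fun t => f (deriv σ t) - f 1) =O[atTop] fun t : ℝ => t ^ (-μ - 1) :=
  (hf.isBigO_sub.comp_tendsto (hσ.tendsto_deriv hμ)).trans (hσ.isBigO_deriv_sub_one hμ)

theorem isBigO_inv_sub_inv (hσ : IsLeafProfile μ φ σ) (hμ : 0 < μ) :
    (fun t => (σ t)⁻¹ - t⁻¹) =O[atTop] fun t : ℝ => t ^ (-μ - 2) := by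
  refine (isBigO_rpow_mul hσ.isBigO_sub_self (isBigO_rpow_mul (hσ.isBigO_inv hμ)
    isBigO_inv_rpow rfl) (c := -μ - 2) (by ring)).neg_left.congr' ?_ EventuallyEq.rfl
  filter_upwards [eventually_gt_atTop 0] with t ht
  have := (hσ.pos t).ne'
  field_simp
  ring

theorem f0_isBigO (hσ : IsLeafProfile μ φ σ) {a : ℝ}
    (h : ExpandsAtTop μ a (fun t => σ t - t)) :
    (fun t => f0 σ t - a * (1 + μ) * t ^ (-μ)) =O[atTop] fun t : ℝ => t ^ (-(1 / 2) : ℝ) := by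
  have h1 := h.isBigO_deriv
  rw [hσ.deriv_sub_self] at h1
  refine (h.isBigO.sub (isBigO_rpow_mul isBigO_self_rpow h1 (c := -(1 / 2))
    (by norm_num))).congr' ?_ EventuallyEq.rfl
  filter_upwards [eventually_gt_atTop 0] with t ht
  rw [f0, Real.rpow_sub_one ht.ne']
  field_simp
  ring

theorem isBigO_f0 (hσ : IsLeafProfile μ φ σ) (hμ' : μ < 1 / 2) {a : ℝ}
    (h : ExpandsAtTop μ a (fun t => σ t - t)) : f0 σ =O[atTop] fun t : ℝ => t ^ (-μ) := by
  simpa using (isBigO_rpow_of_le (hσ.f0_isBigO h) (b := -μ) (by linarith)).add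
    ((isBigO_refl (fun t : ℝ => t ^ (-μ)) atTop).const_mul_left (a * (1 + μ)))

theorem isBigO_inv_f0 (hσ : IsLeafProfile μ φ σ) (hμ : 0 < μ) (hμ' : μ < 1 / 2) {a : ℝ}
    (ha : 0 < a) (h : ExpandsAtTop μ a (fun t => σ t - t)) :
    (fun t => (f0 σ t)⁻¹) =O[atTop] fun t : ℝ => t ^ μ := by
  have h1 : (fun t : ℝ => t ^ (-μ)) =O[atTop] f0 σ :=
    rpow_isBigO_of_sub_isBigO (by positivity) (by linarith) (hσ.f0_isBigO h)
  refine (h1.inv_rev ?_).congr' EventuallyEq.rfl ?_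
  · filter_upwards [eventually_gt_atTop 0] with t ht h0
    exact absurd h0 (Real.rpow_pos_of_pos ht _).ne'
  · filter_upwards [eventually_gt_atTop 0] with t ht
    rw [Real.rpow_neg ht.le, inv_inv]

/-- The derivative of `f₁ / f₀` is integrable at infinity: the inner integral grows like
`t ^ (1/2 - μ)`, and `p f₀²` like `t ^ (2 - 2 μ)`. -/
theorem isBigO_slope (hφ : IsGenerator φ) (hσ : IsLeafProfile μ φ σ) (hμ : 0 < μ)
    (hμ' : μ < 1 / 2) {a : ℝ} (ha : 0 < a) (h : ExpandsAtTop μ a (fun t => σ t - t)) :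
    (fun t => t * reducedSlope φ σ t) =O[atTop] fun t : ℝ => t ^ (μ - 3 / 2) := by
  have hf0 := hσ.isBigO_f0 hμ' h
  have hf0i := hσ.isBigO_inv_f0 hμ hμ' ha h
  have hσO : σ =O[atTop] fun t : ℝ => t ^ (1 : ℝ) := by
    simpa only [Real.rpow_one] using (hσ.isTheta_rpow hμ 1).1
  have hc2 : Continuous (deriv (deriv φ)) := hφ.contDiff_deriv_deriv.continuous
  have hW : reducedWeight φ σ =O[atTop] fun t : ℝ => t ^ (1 : ℝ) :=
    isBigO_rpow_mul hσO (hσ.isBigO_comp_deriv hμ hc2.continuousAt) (by norm_num)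
  have hWi : (fun t => (reducedWeight φ σ t)⁻¹) =O[atTop] fun t : ℝ => t ^ (-1 : ℝ) := by
    refine (isBigO_rpow_mul (hσ.isBigO_inv hμ) (hσ.isBigO_comp_deriv hμ
      (hc2.continuousAt.inv₀ (hφ.deriv_deriv_pos 1).ne')) (c := -1) (by norm_num)).congr_left ?_
    intro t
    rw [reducedWeight, mul_inv, Pi.inv_apply]
  have hg : (fun t => t * reducedSource φ σ t) =O[atTop] fun t : ℝ => t ^ (1 / 2 - μ - 1) :=
    isBigO_rpow_mul isBigO_self_rpow (isBigO_rpow_mul (isBigO_rpow_mul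
      (hσ.isTheta_rpow hμ (-(5 / 2))).1 hW rfl) hf0 rfl) (by ring)
  have hI := isBigO_of_deriv_isBigO_of_pos
    (fun t _ => hσ.hasDerivAt_sq_mul_reducedPrimitive hφ t) (by linarith) hg
  refine (isBigO_rpow_mul (isBigO_rpow_mul hI isBigO_inv_rpow rfl) (isBigO_rpow_mul
    (isBigO_rpow_mul hf0i hf0i rfl) hWi rfl) (c := μ - 3 / 2) (by ring)).congr' ?_
    EventuallyEq.rfl
  filter_upwards [eventually_gt_atTop 0] with t ht
  have w1 := (hσ.reducedWeight_pos hφ t).ne'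
  have w2 := (hσ.f0_pos hμ t).ne'
  rw [reducedSlope]
  field_simp

/-- The expansion of `f₁`: the right hand side `σ ^ (-5/2)` and the difference between the
linearized operator and the Euler operator of the cone contribute terms of order `τ ^ (-5/2)`. -/
theorem exists_expandsAtTop_f1 (hφ : IsGenerator φ) (hσ : IsLeafProfile μ φ σ) (hμ : 0 < μ)
    (hμ' : μ < 1 / 2) (hP : coeffP φ 1 = μ * (1 - μ)) :
    ∃ b, ExpandsAtTop μ b (f1 φ σ) := by
  obtain ⟨a, ha, h⟩ := hσ.exists_expandsAtTop hφ hμ hμ' hP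
  have hf0 := hσ.isBigO_f0 hμ' h
  have hslope := hσ.isBigO_slope hφ hμ hμ' ha h
  have hJ : quotientF1 φ σ =O[atTop] fun t : ℝ => t ^ (0 : ℝ) := by
    obtain ⟨l, hl⟩ := exists_sub_isBigO_of_deriv_isBigO_of_neg
      (fun t _ => hσ.hasDerivAt_quotientF1 hφ hμ t) (a := μ - 1 / 2) (by linarith)
      (isBigO_rpow_of_le hslope (by linarith))
    simpa using (isBigO_rpow_of_le hl (b := 0) (by linarith)).add (isBigO_const_rpow l le_rfl)
  have hd2 : deriv (deriv σ) =O[atTop] fun t : ℝ => t ^ (-μ - 2) := by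
    have h2 := h.deriv_deriv_isBigO_rpow hμ'
    rw [hσ.deriv_sub_self] at h2
    simpa using h2
  have hf : f1 φ σ =O[atTop] fun t : ℝ => t ^ (-μ) := by
    rw [show f1 φ σ = fun τ => f0 σ τ * quotientF1 φ σ τ from funext (f1_eq φ σ)]
    exact isBigO_rpow_mul hf0 hJ (by ring)
  have hf' : deriv (f1 φ σ) =O[atTop] fun t : ℝ => t ^ (-μ - 1) := by
    rw [show deriv (f1 φ σ) = _ from funext fun t => (hσ.hasDerivAt_f1 hφ hμ t).deriv]
    refine IsBigO.add (isBigO_rpow_mul (isBigO_rpow_mul isBigO_self_rpow hd2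
      rfl).neg_left hJ (by ring)) ?_
    exact isBigO_rpow_of_le (isBigO_rpow_mul hf0 hslope rfl) (by linarith)
  have hPd : DifferentiableAt ℝ (deriv (coeffP φ)) 1 :=
    (contDiff_infty_iff_deriv.1 hφ.contDiff_coeffP).2.differentiable (by simp) 1
  have hQd : DifferentiableAt ℝ (deriv (coeffQ φ)) 1 :=
    (contDiff_infty_iff_deriv.1 hφ.contDiff_coeffQ).2.differentiable (by simp) 1
  have hQ : DifferentiableAt ℝ (coeffQ φ) 1 := hφ.contDiff_coeffQ.differentiable (by simp) 1
  have hinv := hσ.isBigO_inv hμ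
  have hsub := hσ.isBigO_inv_sub_inv hμ
  have hcoef1 : (fun t => deriv (coeffP φ) (deriv σ t) / t + deriv (coeffQ φ) (deriv σ t) / σ t
      - 2 / t) =O[atTop] fun t : ℝ => t ^ (-μ - 2) := by
    refine (((isBigO_rpow_mul (hσ.isBigO_comp_deriv_sub hμ hPd) isBigO_inv_rpow
      (c := -μ - 2) (by ring)).add (isBigO_rpow_mul (hσ.isBigO_comp_deriv_sub hμ hQd) hinv
      (c := -μ - 2) (by ring))).add (hsub.const_mul_left (deriv (coeffQ φ) 1))).congr_left ?_
    intro t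
    have hsum : deriv (coeffQ φ) 1 = 2 - deriv (coeffP φ) 1 := by
      linarith [hφ.deriv_coeffP_add_deriv_coeffQ_one]
    rw [hsum]
    ring
  have hcoef0 : (fun t => -(coeffQ φ (deriv σ t) / σ t ^ 2) - μ * (1 - μ) / t ^ 2) =O[atTop]
      fun t : ℝ => t ^ (-μ - 3) := by
    refine ((isBigO_rpow_mul (isBigO_rpow_mul (hσ.isBigO_comp_deriv_sub hμ hQ) hinv rfl) hinv
      (c := -μ - 3) (by ring)).neg_left.add ((isBigO_rpow_mul hsub (hinv.add isBigO_inv_rpow)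
      (c := -μ - 3) (by ring)).const_mul_left (μ * (1 - μ)))).congr_left ?_
    intro t
    rw [hφ.coeffQ_one, hP]
    ring
  refine _root_.exists_expandsAtTop hμ' (contDiff_infty.1 (hσ.contDiff_f1 hφ hμ) 2) ?_
  have e1 := isBigO_rpow_of_le (isBigO_rpow_mul hcoef1 hf' rfl) (b := -(5 / 2)) (by linarith)
  have e0 := isBigO_rpow_of_le (isBigO_rpow_mul hcoef0 hf rfl) (b := -(5 / 2)) (by linarith)
  refine (((hσ.isTheta_rpow hμ (-(5 / 2))).1.sub e1).sub e0).congr' ?_ EventuallyEq.rfl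
  filter_upwards [eventually_gt_atTop 0] with t ht
  rw [← hσ.opL_f1 hφ hμ, opL_of_ne_zero hφ hσ _ ht.ne']
  ring

end IsLeafProfile

/-! ### Error terms -/

theorem exists_pos_forall_ge_one_abs_le {f : ℝ → ℝ} {e : ℝ} (hf : ContinuousOn f (Ioi 0))
    (h : f =O[atTop] fun t : ℝ => t ^ e) : ∃ K, 0 < K ∧ ∀ t, 1 ≤ t → |f t| ≤ K * t ^ e := by
  obtain ⟨C, hC⟩ := h.bound
  obtain ⟨N, hN⟩ := eventually_atTop.1 hC
  have hsub : Icc 1 N ⊆ Ioi (0 : ℝ) := fun t ht => one_pos.trans_le ht.1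
  have hcont : ContinuousOn (fun t => f t / t ^ e) (Icc 1 N) :=
    (hf.mono hsub).div (continuousOn_id.rpow_const fun t ht => Or.inl (hsub ht).ne')
      fun t ht => (Real.rpow_pos_of_pos (hsub ht) e).ne'
  obtain ⟨K, hK⟩ := isCompact_Icc.exists_bound_of_continuousOn hcont
  refine ⟨max (max C K) 1, by positivity, fun t ht => ?_⟩
  have hp : 0 < t ^ e := Real.rpow_pos_of_pos (by linarith) e
  rcases le_total t N with h1 | h1
  · have h2 := hK t ⟨ht, h1⟩
    rw [norm_div, Real.norm_of_nonneg hp.le, div_le_iff₀ hp] at h2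
    exact h2.trans (mul_le_mul_of_nonneg_right ((le_max_right _ _).trans (le_max_left _ _)) hp.le)
  · have h2 := hN t h1
    rw [Real.norm_of_nonneg hp.le] at h2
    exact h2.trans (mul_le_mul_of_nonneg_right ((le_max_left _ _).trans (le_max_left _ _)) hp.le)

theorem ExpandsAtTop.add_const_mul {μ a b : ℝ} {u v : ℝ → ℝ} (hu : ExpandsAtTop μ a u)
    (hv : ExpandsAtTop μ b v) (hu2 : ContDiff ℝ 2 u) (hv2 : ContDiff ℝ 2 v) (ε : ℝ) :
    ExpandsAtTop μ (a + ε * b) (fun t => u t + ε * v t) := by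
  have du : Differentiable ℝ u := hu2.differentiable (by norm_num)
  have dv : Differentiable ℝ v := hv2.differentiable (by norm_num)
  have du1 : Differentiable ℝ (deriv u) := (contDiff_one_deriv hu2).differentiable (by norm_num)
  have dv1 : Differentiable ℝ (deriv v) := (contDiff_one_deriv hv2).differentiable (by norm_num)
  have e1 : deriv (fun t => u t + ε * v t) = fun t => deriv u t + ε * deriv v t := funext fun t =>
    ((du t).hasDerivAt.fun_add ((dv t).hasDerivAt.const_mul ε)).deriv
  have e2 : deriv (deriv fun t => u t + ε * v t)
      = fun t => deriv (deriv u) t + ε * deriv (deriv v) t := by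
    rw [e1]
    exact funext fun t => ((du1 t).hasDerivAt.fun_add ((dv1 t).hasDerivAt.const_mul ε)).deriv
  refine ⟨?_, ?_, ?_⟩
  · exact (hu.isBigO.add (hv.isBigO.const_mul_left ε)).congr_left fun t => by ring
  · rw [e1]
    exact (hu.isBigO_deriv.add (hv.isBigO_deriv.const_mul_left ε)).congr_left fun t => by ring
  · rw [e2]
    exact (hu.isBigO_deriv_deriv.add (hv.isBigO_deriv_deriv.const_mul_left ε)).congr_left
      fun t => by ring

theorem deriv_rpow_eventuallyEq (p : ℝ) {τ : ℝ} (hτ : 0 < τ) :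
    deriv (fun t : ℝ => t ^ p) =ᶠ[𝓝 τ] fun t => p * t ^ (p - 1) := by
  filter_upwards [lt_mem_nhds hτ] with t ht
  exact (Real.hasDerivAt_rpow_const (Or.inl ht.ne')).deriv

theorem deriv_deriv_rpow_of_pos (p : ℝ) {τ : ℝ} (hτ : 0 < τ) :
    deriv (deriv fun t : ℝ => t ^ p) τ = p * ((p - 1) * τ ^ (p - 1 - 1)) := by
  rw [(deriv_rpow_eventuallyEq p hτ).deriv_eq]
  exact ((Real.hasDerivAt_rpow_const (Or.inl hτ.ne')).const_mul p).deriv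

theorem ExpandsAtTop.exists_isErrorTerm {μ a : ℝ} {u : ℝ → ℝ} (h : ExpandsAtTop μ a u)
    (hu : ContDiff ℝ (⊤ : ℕ∞) u) : ∃ C, 0 < C ∧ ∀ c, 0 < c → c ≤ C →
      IsErrorTerm c (fun τ : ℝ => τ ^ (-(1 / 2) : ℝ)) (fun τ => u τ - a * τ ^ (-μ)) := by
  have hu1 := (contDiff_infty_iff_deriv.1 hu).2
  have hu2 := (contDiff_infty_iff_deriv.1 hu1).2
  have hpow : ∀ e : ℝ, ContinuousOn (fun t : ℝ => t ^ e) (Ioi 0) := fun e =>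
    continuousOn_id.rpow_const fun t ht => Or.inl (ne_of_gt ht)
  obtain ⟨K0, hK0, h0⟩ := exists_pos_forall_ge_one_abs_le
    (hu.continuous.continuousOn.sub ((hpow _).const_mul a)) h.isBigO
  obtain ⟨K1, hK1, h1⟩ := exists_pos_forall_ge_one_abs_le
    (hu1.continuous.continuousOn.add ((hpow _).const_mul (a * μ))) h.isBigO_deriv
  obtain ⟨K2, hK2, h2⟩ := exists_pos_forall_ge_one_abs_le
    (hu2.continuous.continuousOn.sub ((hpow _).const_mul (a * μ * (μ + 1)))) h.isBigO_deriv_deriv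
  set K := 2 * (K0 + K1 + K2) with hK
  refine ⟨K⁻¹, by positivity, fun c hc hcK => ⟨?_, fun τ hτ => ?_⟩⟩
  · refine hu.contDiffOn.sub (contDiffOn_const.mul ?_)
    exact contDiffOn_id.rpow_const_of_ne fun t ht => ne_of_gt ht
  have hτ0 : 0 < τ := by linarith
  have hcK' : K ≤ c⁻¹ := by rwa [le_inv_comm₀ (by positivity) hc]
  have d1 : ∀ t : ℝ, 0 < t → HasDerivAt (fun τ => u τ - a * τ ^ (-μ))
      (deriv u t + a * μ * t ^ (-μ - 1)) t := fun t ht =>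
    ((hu.differentiable (by simp) t).hasDerivAt.fun_sub ((Real.hasDerivAt_rpow_const
      (Or.inl ht.ne')).const_mul a)).congr_deriv (by ring)
  have d1' : deriv (fun τ => u τ - a * τ ^ (-μ)) =ᶠ[𝓝 τ]
      fun t => deriv u t + a * μ * t ^ (-μ - 1) := by
    filter_upwards [lt_mem_nhds hτ0] with t ht using (d1 t ht).deriv
  have d2 : deriv (deriv fun τ => u τ - a * τ ^ (-μ)) τ
      = deriv (deriv u) τ - a * μ * (μ + 1) * τ ^ (-μ - 2) := by
    rw [d1'.deriv_eq]
    refine (((hu1.differentiable (by simp) τ).hasDerivAt.fun_add ((Real.hasDerivAt_rpow_const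
      (p := -μ - 1) (Or.inl hτ0.ne')).const_mul (a * μ))).congr_deriv ?_).deriv
    rw [show -μ - 1 - 1 = -μ - 2 by ring]
    ring
  have p0 : 0 < τ ^ (-(1 / 2) : ℝ) := Real.rpow_pos_of_pos hτ0 _
  have p1 : 0 < τ ^ (-(3 / 2) : ℝ) := Real.rpow_pos_of_pos hτ0 _
  have p2 : 0 < τ ^ (-(5 / 2) : ℝ) := Real.rpow_pos_of_pos hτ0 _
  refine ⟨?_, ?_, ?_⟩
  · rw [abs_of_pos p0]
    exact (h0 τ hτ).trans (mul_le_mul_of_nonneg_right (by linarith) p0.le)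
  · rw [d1'.self_of_nhds, (deriv_rpow_eventuallyEq _ hτ0).self_of_nhds, abs_mul,
      show (-(1 / 2) - 1 : ℝ) = -(3 / 2) by norm_num, abs_of_pos p1,
      show |(-(1 / 2) : ℝ)| = 1 / 2 by norm_num, ← mul_assoc]
    exact (h1 τ hτ).trans (mul_le_mul_of_nonneg_right (by linarith) p1.le)
  · rw [d2, deriv_deriv_rpow_of_pos _ hτ0, ← mul_assoc, abs_mul,
      show (-(1 / 2) - 1 - 1 : ℝ) = -(5 / 2) by norm_num, abs_of_pos p2,
      show |(-(1 / 2) * (-(1 / 2) - 1) : ℝ)| = 3 / 4 by norm_num, ← mul_assoc]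
    exact (h2 τ hτ).trans (mul_le_mul_of_nonneg_right (by linarith) p2.le)

/-! ### The perturbed profiles -/

/-- The profile `σ + ε f₁`. -/
noncomputable def perturbedProfile (φ σ : ℝ → ℝ) (ε τ : ℝ) : ℝ := σ τ + ε * f1 φ σ τ

namespace IsLeafProfile

variable {μ : ℝ} {φ σ : ℝ → ℝ}

theorem continuous_rpow (hσ : IsLeafProfile μ φ σ) (e : ℝ) : Continuous fun t => σ t ^ e :=
  hσ.contDiff.continuous.rpow_const fun t => Or.inl (hσ.pos t).ne'

theorem exists_abs_le_rpow (hσ : IsLeafProfile μ φ σ) (hμ : 0 < μ) {f : ℝ → ℝ} {e : ℝ}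
    (hf : Continuous f) (hfe : ∀ t, |f (-t)| = |f t|) (h : f =O[atTop] fun t : ℝ => t ^ e) :
    ∃ C, 0 < C ∧ ∀ t, |f t| ≤ C * σ t ^ e :=
  exists_pos_forall_abs_le_of_isBigO hf (hσ.continuous_rpow e)
    (fun t => Real.rpow_pos_of_pos (hσ.pos t) e) hfe (fun t => by rw [hσ.even])
    (h.trans (hσ.isTheta_rpow hμ e).2)

theorem exists_rpow_le (hσ : IsLeafProfile μ φ σ) (hμ : 0 < μ) {g : ℝ → ℝ} {e : ℝ}
    (hg : Continuous g) (hg0 : ∀ t, 0 < g t) (hge : ∀ t, g (-t) = g t)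
    (h : (fun t : ℝ => t ^ e) =O[atTop] g) : ∃ C, 0 < C ∧ ∀ t, σ t ^ e ≤ C * g t := by
  obtain ⟨C, hC, hb⟩ := exists_pos_forall_abs_le_of_isBigO (hσ.continuous_rpow e) hg hg0
    (fun t => by rw [hσ.even]) hge ((hσ.isTheta_rpow hμ e).1.trans h)
  exact ⟨C, hC, fun t => (le_abs_self _).trans (hb t)⟩

theorem contDiff_perturbedProfile (hφ : IsGenerator φ) (hσ : IsLeafProfile μ φ σ) (hμ : 0 < μ)
    (ε : ℝ) : ContDiff ℝ (⊤ : ℕ∞) (perturbedProfile φ σ ε) :=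
  hσ.contDiff.add (contDiff_const.mul (hσ.contDiff_f1 hφ hμ))

theorem perturbedProfile_neg (hφ : IsGenerator φ) (hσ : IsLeafProfile μ φ σ) (ε τ : ℝ) :
    perturbedProfile φ σ ε (-τ) = perturbedProfile φ σ ε τ := by
  rw [perturbedProfile, perturbedProfile, hσ.even, hσ.f1_neg hφ]

theorem deriv_perturbedProfile (hφ : IsGenerator φ) (hσ : IsLeafProfile μ φ σ) (hμ : 0 < μ)
    (ε : ℝ) : deriv (perturbedProfile φ σ ε) = fun τ => deriv σ τ + ε * deriv (f1 φ σ) τ :=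
  funext fun τ => ((hσ.differentiable τ).hasDerivAt.fun_add
    (((hσ.contDiff_f1 hφ hμ).differentiable (by simp) τ).hasDerivAt.const_mul ε)).deriv

theorem deriv_deriv_perturbedProfile (hφ : IsGenerator φ) (hσ : IsLeafProfile μ φ σ) (hμ : 0 < μ)
    (ε : ℝ) : deriv (deriv (perturbedProfile φ σ ε))
      = fun τ => deriv (deriv σ) τ + ε * deriv (deriv (f1 φ σ)) τ := by
  rw [hσ.deriv_perturbedProfile hφ hμ]
  exact funext fun τ => ((hσ.differentiable_deriv τ).hasDerivAt.fun_add
    (((contDiff_infty_iff_deriv.1 (hσ.contDiff_f1 hφ hμ)).2.differentiable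
      (by simp) τ).hasDerivAt.const_mul ε)).deriv

/-- Along the perturbation, the operator is its linearization up to a quadratic error, which decays
like `τ ^ (-3 - 2 μ)` and hence is dominated by the right hand side `σ ^ (-5/2)`. -/
theorem exists_abs_opG_sub_le (hφ : IsGenerator φ) (hσ : IsLeafProfile μ φ σ) (hμ : 0 < μ)
    (hμ' : μ < 1 / 2) {b : ℝ} (h : ExpandsAtTop μ b (f1 φ σ)) :
    ∃ C, 0 < C ∧ ∃ δ, 0 < δ ∧ ∀ ε, |ε| ≤ δ → (∀ τ, 0 < perturbedProfile φ σ ε τ) ∧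
      ∀ τ, |opG φ (perturbedProfile φ σ ε) τ - ε * σ τ ^ (-(5 / 2) : ℝ)|
        ≤ C * ε ^ 2 * σ τ ^ (-(5 / 2) : ℝ) := by
  have hf := hσ.contDiff_f1 hφ hμ
  have hf1 := (contDiff_infty_iff_deriv.1 hf).2
  have hfodd := deriv_neg_of_even (hσ.f1_neg hφ)
  have c0 := hf.continuous
  have c1 := hf1.continuous
  have cm : Continuous (divByVar (deriv (f1 φ σ))) :=
    continuous_divByVar (hf1.differentiable (by simp)) (deriv_zero_of_even (hσ.f1_neg hφ))
  have cσ := hσ.contDiff.continuous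
  have nσ : ∀ t, σ t ≠ 0 := fun t => (hσ.pos t).ne'
  have meven : ∀ t, divByVar (deriv (f1 φ σ)) (-t) = divByVar (deriv (f1 φ σ)) t := fun t => by
    rcases eq_or_ne t 0 with rfl | ht
    · rw [neg_zero]
    · rw [divByVar, divByVar, if_neg ht, if_neg (neg_ne_zero.2 ht), hfodd, neg_div_neg_eq]
  have b0 := h.isBigO_rpow hμ'
  have b1 := h.deriv_isBigO_rpow hμ'
  have bm : divByVar (deriv (f1 φ σ)) =O[atTop] fun t : ℝ => t ^ (-μ - 2) := by
    refine (isBigO_rpow_mul b1 isBigO_inv_rpow (c := -μ - 2) (by ring)).congr' ?_ EventuallyEq.rfl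
    filter_upwards [eventually_gt_atTop 0] with t ht
    rw [divByVar, if_neg ht.ne', div_eq_mul_inv]
  have bi := hσ.isBigO_inv hμ
  -- the quadratic expression that controls the remainder
  set ρ : ℝ → ℝ := fun t => |deriv (f1 φ σ) t| * |divByVar (deriv (f1 φ σ)) t|
    + |deriv (f1 φ σ) t| * |deriv (f1 φ σ) t| * (σ t)⁻¹
    + |deriv (f1 φ σ) t| * |f1 φ σ t| * ((σ t)⁻¹ * (σ t)⁻¹)
    + |f1 φ σ t| * |f1 φ σ t| * ((σ t)⁻¹ * (σ t)⁻¹ * (σ t)⁻¹) with hρ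
  have hρO : ρ =O[atTop] fun t : ℝ => t ^ (-(5 / 2) : ℝ) := by
    refine isBigO_rpow_of_le (a := -2 * μ - 3) ?_ (by linarith)
    have q0 := b0.norm_left
    have q1 := b1.norm_left
    exact (((isBigO_rpow_mul q1 bm.norm_left (by ring)).add
      (isBigO_rpow_mul (isBigO_rpow_mul q1 q1 rfl) bi (by ring))).add
      (isBigO_rpow_mul (isBigO_rpow_mul q1 q0 rfl) (isBigO_rpow_mul bi bi rfl) (by ring))).add
      (isBigO_rpow_mul (isBigO_rpow_mul q0 q0 rfl)
        (isBigO_rpow_mul (isBigO_rpow_mul bi bi rfl) bi rfl) (by ring))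
  have hρc : Continuous ρ := by
    have ci := cσ.inv₀ nσ
    exact (((c1.abs.mul cm.abs).add ((c1.abs.mul c1.abs).mul ci)).add
      ((c1.abs.mul c0.abs).mul (ci.mul ci))).add
      ((c0.abs.mul c0.abs).mul ((ci.mul ci).mul ci))
  have hρe : ∀ t, ρ (-t) = ρ t := fun t => by
    simp only [hρ, hfodd, meven, hσ.even, hσ.f1_neg hφ, abs_neg]
  obtain ⟨M, hM, hMb⟩ := hσ.exists_abs_le_rpow hμ hρc (fun t => by rw [hρe]) hρO
  obtain ⟨M0, hM0, hMb0⟩ := hσ.exists_abs_le_rpow hμ c0 (fun t => by rw [hσ.f1_neg hφ])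
    (isBigO_rpow_of_le b0 (b := 0) (by linarith))
  obtain ⟨M1, hM1, hMb1⟩ := hσ.exists_abs_le_rpow hμ c1 (fun t => by rw [hfodd, abs_neg])
    (isBigO_rpow_of_le b1 (b := 0) (by linarith))
  simp only [Real.rpow_zero, mul_one] at hMb0 hMb1
  obtain ⟨C, hC, hrem⟩ := exists_abs_remainder_le (contDiff_infty.1 hφ.contDiff_coeffP 2)
    (contDiff_infty.1 hφ.contDiff_coeffQ 2)
  refine ⟨C * M, by positivity, 1 / (2 * (M0 + M1)), by positivity, fun ε hε => ?_⟩
  rw [le_div_iff₀ (by positivity)] at hε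
  have hk : ∀ τ, |ε * f1 φ σ τ| ≤ 1 / 2 := fun τ => by
    rw [abs_mul]
    nlinarith [mul_le_mul_of_nonneg_left (hMb0 τ) (abs_nonneg ε), abs_nonneg ε]
  have hh : ∀ τ, |ε * deriv (f1 φ σ) τ| ≤ 1 / 2 := fun τ => by
    rw [abs_mul]
    nlinarith [mul_le_mul_of_nonneg_left (hMb1 τ) (abs_nonneg ε), abs_nonneg ε]
  have hpos : ∀ τ, 0 < perturbedProfile φ σ ε τ := fun τ => by
    rw [perturbedProfile]
    linarith [hσ.one_le τ, (abs_le.1 (hk τ)).1]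
  refine ⟨hpos, fun τ => ?_⟩
  have hsmooth := contDiff_infty.1 (hσ.contDiff_perturbedProfile hφ hμ ε) 2
  have cS := hσ.continuous_rpow (-(5 / 2))
  -- both sides are continuous, so that the axis `τ = 0` may be left out
  have hclosed : IsClosed {τ | |opG φ (perturbedProfile φ σ ε) τ - ε * σ τ ^ (-(5 / 2) : ℝ)|
        ≤ C * M * ε ^ 2 * σ τ ^ (-(5 / 2) : ℝ)} :=
    isClosed_le ((continuous_opG hφ hsmooth (fun τ => (hpos τ).ne')
      (hσ.perturbedProfile_neg hφ ε)).sub (continuous_const.mul cS)).abs (continuous_const.mul cS)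
  refine closure_minimal (s := {(0 : ℝ)}ᶜ) (fun τ hτ => ?_) hclosed
    (dense_compl_singleton (0 : ℝ) τ)
  replace hτ : τ ≠ 0 := hτ
  rw [mem_ofPred_eq]
  have hslope := abs_lt.1 (hσ.abs_deriv_lt_one hμ τ)
  have hhτ := abs_le.1 (hh τ)
  have hr := hrem (deriv σ τ) (ε * deriv (f1 φ σ) τ) (σ τ) (ε * f1 φ σ τ) τ
    ⟨by linarith, by linarith⟩ ⟨by linarith, by linarith⟩ (hσ.pos τ)
    ((hk τ).trans (by linarith [hσ.one_le τ]))
  have heq := hσ.equation τ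
  rw [opG_of_ne_zero _ _ hτ] at heq
  have hL := hσ.opL_f1 hφ hμ τ
  rw [opL_of_ne_zero hφ hσ _ hτ] at hL
  rw [opG_of_ne_zero _ _ hτ, hσ.deriv_deriv_perturbedProfile hφ hμ,
    hσ.deriv_perturbedProfile hφ hμ, perturbedProfile]
  have hρτ : (ε * deriv (f1 φ σ) τ) ^ 2 / |τ| + (ε * deriv (f1 φ σ) τ) ^ 2 / σ τ
      + |ε * deriv (f1 φ σ) τ| * |ε * f1 φ σ τ| / σ τ ^ 2 + (ε * f1 φ σ τ) ^ 2 / σ τ ^ 3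
      = ε ^ 2 * ρ τ := by
    have hτ' : |τ| ≠ 0 := abs_ne_zero.2 hτ
    simp only [hρ, divByVar, if_neg hτ, abs_mul, abs_div]
    rw [← sq_abs (ε * deriv (f1 φ σ) τ), ← sq_abs (ε * f1 φ σ τ), abs_mul, abs_mul, ← sq_abs ε]
    field_simp
  rw [hρτ] at hr
  calc _ = _ := by
        congr 1
        linear_combination heq + ε * hL
    _ ≤ _ := hr
    _ ≤ C * (ε ^ 2 * (M * σ τ ^ (-(5 / 2) : ℝ))) := by
        gcongr
        exact (le_abs_self _).trans (hMb τ)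
    _ = _ := by ring

theorem exists_perturbedProfile_convex (hφ : IsGenerator φ) (hσ : IsLeafProfile μ φ σ)
    (hμ : 0 < μ) (hμ' : μ < 1 / 2) {a b : ℝ} (ha : 0 < a)
    (hv : ExpandsAtTop μ a (fun t => σ t - t)) (h : ExpandsAtTop μ b (f1 φ σ)) :
    ∃ δ, 0 < δ ∧ ∀ ε, |ε| ≤ δ → LocallyUniformlyConvex (perturbedProfile φ σ ε) := by
  have hf1 := (contDiff_infty_iff_deriv.1 (hσ.contDiff_f1 hφ hμ)).2
  have hf2 := (contDiff_infty_iff_deriv.1 hf1).2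
  have hodd := deriv_neg_of_even (hσ.f1_neg hφ)
  have hv2 := hv.isBigO_deriv_deriv
  have hd2 : deriv (deriv fun t => σ t - t) = deriv (deriv σ) := by
    rw [hσ.deriv_sub_self]
    ext t
    simp
  rw [hd2] at hv2
  obtain ⟨C, hC, hCb⟩ := hσ.exists_rpow_le hμ hσ.contDiff_deriv_deriv.continuous
    hσ.deriv_deriv_pos (deriv_neg_of_odd (deriv_neg_of_even hσ.even))
    (rpow_isBigO_of_sub_isBigO (by positivity) (by linarith) hv2)
  obtain ⟨M, hM, hMb⟩ := hσ.exists_abs_le_rpow hμ hf2.continuous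
    (fun t => by rw [deriv_neg_of_odd hodd]) (h.deriv_deriv_isBigO_rpow hμ')
  refine ⟨1 / (2 * (M * C)), by positivity, fun ε hε => ?_⟩
  refine locallyUniformlyConvex_of_deriv_deriv_pos
    (contDiff_infty.1 (hσ.contDiff_perturbedProfile hφ hμ ε) 2) fun t => ?_
  rw [hσ.deriv_deriv_perturbedProfile hφ hμ]
  have h1 : |ε * deriv (deriv (f1 φ σ)) t| ≤ deriv (deriv σ) t / 2 := by
    rw [abs_mul]
    calc _ ≤ 1 / (2 * (M * C)) * (M * (C * deriv (deriv σ) t)) :=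
          mul_le_mul hε ((hMb t).trans (mul_le_mul_of_nonneg_left (hCb t) hM.le)) (abs_nonneg _)
            (by positivity)
      _ = _ := by field_simp
  linarith [(abs_le.1 h1).1, hσ.deriv_deriv_pos t]

theorem exists_abs_lt_perturbedProfile (hφ : IsGenerator φ) (hσ : IsLeafProfile μ φ σ)
    (hμ : 0 < μ) (hμ' : μ < 1 / 2) {a b : ℝ} (ha : 0 < a)
    (hv : ExpandsAtTop μ a (fun t => σ t - t)) (h : ExpandsAtTop μ b (f1 φ σ)) :
    ∃ δ, 0 < δ ∧ ∀ ε, |ε| ≤ δ → ∀ τ, |τ| < perturbedProfile φ σ ε τ := by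
  have hO : (fun t : ℝ => t ^ (-μ)) =O[atTop] fun t => σ t - |t| := by
    refine (rpow_isBigO_of_sub_isBigO ha.ne' (by linarith) hv.isBigO).congr' EventuallyEq.rfl ?_
    filter_upwards [eventually_gt_atTop 0] with t ht
    rw [abs_of_pos ht]
  obtain ⟨C, hC, hCb⟩ := hσ.exists_rpow_le hμ (hσ.contDiff.continuous.fun_sub continuous_abs)
    (fun t => sub_pos.2 (hσ.above_cone t)) (fun t => by rw [hσ.even, abs_neg]) hO
  obtain ⟨M, hM, hMb⟩ := hσ.exists_abs_le_rpow hμ (hσ.contDiff_f1 hφ hμ).continuous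
    (fun t => by rw [hσ.f1_neg hφ]) (h.isBigO_rpow hμ')
  refine ⟨1 / (2 * (M * C)), by positivity, fun ε hε t => ?_⟩
  have h1 : |ε * f1 φ σ t| ≤ (σ t - |t|) / 2 := by
    rw [abs_mul]
    calc _ ≤ 1 / (2 * (M * C)) * (M * (C * (σ t - |t|))) :=
          mul_le_mul hε ((hMb t).trans (mul_le_mul_of_nonneg_left (hCb t) hM.le)) (abs_nonneg _)
            (by positivity)
      _ = _ := by field_simp
  rw [perturbedProfile]
  linarith [(abs_le.1 h1).1, hσ.above_cone t]

/-- The tangent at `2 τ` lies below the graph at `τ`. -/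
theorem half_add_half_f0_le (hσ : IsLeafProfile μ φ σ) (τ : ℝ) :
    1 / 2 * σ (2 * τ) + 1 / 2 * f0 σ (2 * τ) ≤ σ τ := by
  have h := add_deriv_mul_sub_le hσ.contDiff_two hσ.deriv_deriv_pos (2 * τ) τ
  rw [f0]
  linarith

theorem exists_half_perturbedProfile_le (hφ : IsGenerator φ) (hσ : IsLeafProfile μ φ σ)
    (hμ : 0 < μ) (hμ' : μ < 1 / 2) {a b : ℝ} (ha : 0 < a)
    (hv : ExpandsAtTop μ a (fun t => σ t - t)) (h : ExpandsAtTop μ b (f1 φ σ)) :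
    ∃ δ, 0 < δ ∧ ∀ ε, 0 ≤ ε → ε ≤ δ → ∀ τ,
      1 / 2 * perturbedProfile φ σ ε (2 * τ) ≤ perturbedProfile φ σ (-ε) τ := by
  obtain ⟨C, hC, hCb⟩ := hσ.exists_rpow_le hμ hσ.contDiff_f0.continuous (hσ.f0_pos hμ) hσ.f0_neg
    (rpow_isBigO_of_sub_isBigO (by positivity) (by linarith) (hσ.f0_isBigO hv))
  obtain ⟨M, hM, hMb⟩ := hσ.exists_abs_le_rpow hμ (hσ.contDiff_f1 hφ hμ).continuous
    (fun t => by rw [hσ.f1_neg hφ]) (h.isBigO_rpow hμ')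
  refine ⟨1 / (5 * (M * C)), by positivity, fun ε hε0 hε t => ?_⟩
  have h1 := hσ.half_add_half_f0_le t
  have hp := hσ.pos (2 * t)
  have hf0 := hσ.f0_pos hμ (2 * t)
  -- `σ (2 t) ≤ 2 σ t`, so that `σ (2 t)` may serve as the weight at `t`
  have h2 : σ t ^ (-μ) ≤ 2 * σ (2 * t) ^ (-μ) := by
    calc σ t ^ (-μ) ≤ (1 / 2 * σ (2 * t)) ^ (-μ) :=
          Real.rpow_le_rpow_of_nonpos (by positivity) (by linarith) (by linarith)
      _ = 2 ^ μ * σ (2 * t) ^ (-μ) := by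
          rw [Real.mul_rpow (by norm_num) hp.le, one_div, Real.inv_rpow (by norm_num),
            Real.rpow_neg (by norm_num), inv_inv]
      _ ≤ 2 * σ (2 * t) ^ (-μ) := by
          have : (2 : ℝ) ^ μ ≤ 2 ^ (1 : ℝ) :=
            Real.rpow_le_rpow_of_exponent_le one_le_two (by linarith)
          rw [Real.rpow_one] at this
          exact mul_le_mul_of_nonneg_right this (Real.rpow_nonneg hp.le _)
  have h3 : f1 φ σ t ≤ 2 * (M * (C * f0 σ (2 * t))) := by
    have := (le_abs_self _).trans (hMb t)
    have h4 := mul_le_mul_of_nonneg_left (h2.trans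
      (mul_le_mul_of_nonneg_left (hCb (2 * t)) two_pos.le)) hM.le
    linarith
  have h5 : f1 φ σ (2 * t) ≤ M * (C * f0 σ (2 * t)) :=
    (le_abs_self _).trans ((hMb _).trans (mul_le_mul_of_nonneg_left (hCb _) hM.le))
  have h6 : ε * (f1 φ σ t + 1 / 2 * f1 φ σ (2 * t)) ≤ 1 / 2 * f0 σ (2 * t) := by
    calc _ ≤ ε * (5 / 2 * (M * (C * f0 σ (2 * t)))) := by
          refine mul_le_mul_of_nonneg_left ?_ hε0
          linarith
      _ ≤ 1 / (5 * (M * C)) * (5 / 2 * (M * (C * f0 σ (2 * t)))) := by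
          gcongr
      _ = _ := by field_simp
  rw [perturbedProfile, perturbedProfile]
  linarith

theorem exists_hasConicalExpansion (hφ : IsGenerator φ) (hσ : IsLeafProfile μ φ σ) (hμ : 0 < μ)
    {a b : ℝ} (hv : ExpandsAtTop μ a (fun t => σ t - t)) (h : ExpandsAtTop μ b (f1 φ σ)) {ε : ℝ}
    (hε : 0 < a + ε * b) : ∃ C, 0 < C ∧ ∀ c, 0 < c → c ≤ C →
      HasConicalExpansion μ c (perturbedProfile φ σ ε) := by
  have hf := hσ.contDiff_f1 hφ hμ
  have hu : ContDiff ℝ (⊤ : ℕ∞) (fun t => σ t - t) := hσ.contDiff.sub contDiff_id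
  obtain ⟨C, hC, hb⟩ := (hv.add_const_mul h (contDiff_infty.1 hu 2) (contDiff_infty.1 hf 2)
    ε).exists_isErrorTerm (hu.add (contDiff_const.mul hf))
  refine ⟨C, hC, fun c hc hcC => ⟨_, hε, _, hb c hc hcC, fun τ _ => ?_⟩⟩
  rw [perturbedProfile]
  ring

end IsLeafProfile

theorem mainTheorem3 (μ : ℝ) (hμ_pos : 0 < μ) (hμ_lt : μ < 1 / 2) (φ σ : ℝ → ℝ)
    (hφ : IsGenerator φ)
    (hμφ : φ 1 / (2 * deriv (deriv φ) 1) = μ * (1 - μ))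
    (hσ : IsLeafProfile μ φ σ) :
    -- `f₁` is the smooth even solution of the linearized initial value problem
    (ContDiff ℝ (⊤ : ℕ∞) (f1 φ σ) ∧ (∀ τ, f1 φ σ (-τ) = f1 φ σ τ) ∧
      f1 φ σ 0 = 0 ∧ deriv (f1 φ σ) 0 = 0 ∧
      ∀ τ, opL φ σ (f1 φ σ) τ = σ τ ^ (-(5 / 2) : ℝ)) ∧
    -- the perturbed profiles
    ∃ ε₀ : ℝ, 0 < ε₀ ∧ ∃ c : ℝ, 0 < c ∧
      ∃ σUp σLow : ℝ → ℝ,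
        (∀ τ, σUp τ = σ τ + ε₀ * f1 φ σ τ) ∧ (∀ τ, σLow τ = σ τ - ε₀ * f1 φ σ τ) ∧
        (∀ τ, σUp (-τ) = σUp τ) ∧ (∀ τ, σLow (-τ) = σLow τ) ∧
        LocallyUniformlyConvex σUp ∧ LocallyUniformlyConvex σLow ∧
        (∀ τ, |τ| < σUp τ) ∧ (∀ τ, |τ| < σLow τ) ∧
        HasConicalExpansion μ c σUp ∧ HasConicalExpansion μ c σLow ∧
        (∀ τ, c * σ τ ^ (-(5 / 2) : ℝ) ≤ opG φ σUp τ) ∧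
        (∀ τ, c * σ τ ^ (-(5 / 2) : ℝ) ≤ -opG φ σLow τ) ∧
        (∀ τ, 1 / 2 * σUp (2 * τ) ≤ σLow τ ∧ σLow τ ≤ σUp τ) := by
  have hP : coeffP φ 1 = μ * (1 - μ) := by rw [hφ.coeffP_one, hμφ]
  obtain ⟨a, ha, hv⟩ := hσ.exists_expandsAtTop hφ hμ_pos hμ_lt hP
  obtain ⟨b, hb⟩ := hσ.exists_expandsAtTop_f1 hφ hμ_pos hμ_lt hP
  obtain ⟨C, hC, δ₁, hδ₁, hG⟩ := hσ.exists_abs_opG_sub_le hφ hμ_pos hμ_lt hb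
  obtain ⟨δ₂, hδ₂, hconv⟩ := hσ.exists_perturbedProfile_convex hφ hμ_pos hμ_lt ha hv hb
  obtain ⟨δ₃, hδ₃, habove⟩ := hσ.exists_abs_lt_perturbedProfile hφ hμ_pos hμ_lt ha hv hb
  obtain ⟨δ₄, hδ₄, hhalf⟩ := hσ.exists_half_perturbedProfile_le hφ hμ_pos hμ_lt ha hv hb
  refine ⟨⟨hσ.contDiff_f1 hφ hμ_pos, hσ.f1_neg hφ, by simp [f1],
    deriv_zero_of_even (hσ.f1_neg hφ), hσ.opL_f1 hφ hμ_pos⟩, ?_⟩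
  obtain ⟨ε, hε, hε1, hε2, hε3, hε4, hεa, hεC⟩ : ∃ ε : ℝ, 0 < ε ∧ ε ≤ δ₁ ∧ ε ≤ δ₂ ∧ ε ≤ δ₃ ∧
      ε ≤ δ₄ ∧ ε * |b| < a ∧ C * ε ≤ 1 / 2 := by
    have h0 : ∀ᶠ ε in 𝓝[>] (0 : ℝ), 0 < ε := self_mem_nhdsWithin
    have h1 : ∀ᶠ ε in 𝓝[>] (0 : ℝ), ε * |b| < a := by
      have : ContinuousAt (fun ε : ℝ => ε * |b|) 0 := by fun_prop
      exact (this.eventually (gt_mem_nhds (by simpa using ha))).filter_mono nhdsWithin_le_nhds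
    have h2 : ∀ᶠ ε in 𝓝[>] (0 : ℝ), C * ε < 1 / 2 := by
      have : ContinuousAt (fun ε : ℝ => C * ε) 0 := by fun_prop
      exact (this.eventually (gt_mem_nhds (by norm_num))).filter_mono nhdsWithin_le_nhds
    have h3 : ∀ {δ : ℝ}, 0 < δ → ∀ᶠ ε in 𝓝[>] (0 : ℝ), ε ≤ δ := fun hδ =>
      ((gt_mem_nhds hδ).filter_mono nhdsWithin_le_nhds).mono fun _ h => le_of_lt h
    obtain ⟨ε, ⟨⟨⟨⟨⟨h0, h1⟩, h2⟩, h3⟩, h4⟩, h5⟩, h6⟩ := (((((h0.and h1).and h2).and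
      (h3 hδ₁)).and (h3 hδ₂)).and (h3 hδ₃)).and (h3 hδ₄) |>.exists
    exact ⟨ε, h0, h3, h4, h5, h6, h1, h2.le⟩
  have hεabs : |ε| = ε := abs_of_pos hε
  have hnegabs : |-ε| = ε := by rw [abs_neg, hεabs]
  have hab : |ε * b| < a := by rwa [abs_mul, hεabs]
  have hab' := abs_lt.1 hab
  obtain ⟨C₁, hC₁, hUp⟩ := hσ.exists_hasConicalExpansion hφ hμ_pos hv hb (ε := ε)
    (by linarith)
  obtain ⟨C₂, hC₂, hLow⟩ := hσ.exists_hasConicalExpansion hφ hμ_pos hv hb (ε := -ε)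
    (by linarith)
  have hc : 0 < min (ε / 2) (min C₁ C₂) := by positivity
  have hquad : C * ε ^ 2 ≤ ε / 2 := by nlinarith
  refine ⟨ε, hε, min (ε / 2) (min C₁ C₂), hc, perturbedProfile φ σ ε, perturbedProfile φ σ (-ε),
    fun _ => rfl, fun τ => by rw [perturbedProfile]; ring, hσ.perturbedProfile_neg hφ ε,
    hσ.perturbedProfile_neg hφ (-ε), hconv _ (by rwa [hεabs]), hconv _ (by rwa [hnegabs]),
    habove _ (by rwa [hεabs]), habove _ (by rwa [hnegabs]),
    hUp _ hc ((min_le_right _ _).trans (min_le_left _ _)),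
    hLow _ hc ((min_le_right _ _).trans (min_le_right _ _)), fun τ => ?_, fun τ => ?_,
    fun τ => ⟨hhalf ε hε.le hε4 τ, ?_⟩⟩
  · have hS : 0 < σ τ ^ (-(5 / 2) : ℝ) := Real.rpow_pos_of_pos (hσ.pos τ) _
    have h1 := (abs_le.1 ((hG ε (by rwa [hεabs])).2 τ)).1
    have h2 := mul_le_mul_of_nonneg_right hquad hS.le
    have h3 := mul_le_mul_of_nonneg_right (min_le_left (ε / 2) (min C₁ C₂)) hS.le
    linarith
  · have hS : 0 < σ τ ^ (-(5 / 2) : ℝ) := Real.rpow_pos_of_pos (hσ.pos τ) _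
    have h1 := (abs_le.1 ((hG (-ε) (by rwa [hnegabs])).2 τ)).2
    have h2 := mul_le_mul_of_nonneg_right hquad hS.le
    have h3 := mul_le_mul_of_nonneg_right (min_le_left (ε / 2) (min C₁ C₂)) hS.le
    rw [neg_sq] at h1
    linarith
  · rw [perturbedProfile, perturbedProfile]
    linarith [mul_nonneg hε.le (hσ.f1_nonneg hφ hμ_pos τ)]
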